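/- Let $d\ge 1$, let $X$ be a finite non-empty subset of the unit sphere $S^{d-1}\subset\mathbb{R}^d$, let $A(X)=\{\langle x,y\rangle \mid x,y\in X,\ x\ne y\}$ and let $s=|A(X)|$ be the degree of $X$. Write $A(X)=\{\alpha_1,\dots,\alpha_s\}$ (in any order) and $\alpha_0=1$, and put $R_i=\{(x,y)\in X\times X \mid \langle x,y\rangle=\alpha_i\}$ for $0\le i\le s$. Let $Q_k$ be the Gegenbauer polynomials on $S^{d-1}$, given by $Q_0(x)=1$, $Q_1(x)=dx$ and $$\frac{k+1}{d+2k}Q_{k+1}(x)=xQ_k(x)-\frac{d+k-3}{d+2k-4}Q_{k-1}(x)\qquad (k\ge 1),$$ where the last fraction is read as $1$ for $k=1$ (also when $d=2$), and let $b_k=\frac{1}{|X|}\sum_{x,y\in X}Q_k(\langle x,y\rangle)$ for $k\ge 0$. For each $l\ge 0$ let $\phi_{l,1},\dots,\phi_{l,h_l}$ be an orthonormal basis of the space of real harmonic homogeneous polynomials of degree $l$ in $d$ variables, with respect to $\langle\phi,\psi\rangle=\frac{1}{|S^{d-1}|}\int_{S^{d-1}}\phi\psi\,d\sigma$, where $\sigma$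 is the surface measure. Let $H_l=(\phi_{l,i}(x))_{x\in X,\,1\le i\le h_l}$ be the $l$-th spherical characteristic matrix and let $F_l=\frac{1}{|X|}H_lH_l^T$. Assume that there is an integer $w\ge 0$ such that $b_w>0$ and $F_kF_l=0$ for all $k,l\in\{0,1,\dots,w+s\}$ with $|k-l|\ge w+1$. Then $(X,\{R_0,\dots,R_s\})$ is an $s$-class $Q$-polynomial scheme. That is, it is a symmetric association scheme with $s$ classes, and the primitive idempotents of its Bose--Mesner algebra can be ordered as $E_0=\frac{1}{|X|}J,E_1,\dots,E_s$ so that for each $0\le i\le s$ there is a real polynomial $v_i$ of degree $i$ with $|X|E_i=v_i(|X|E_1)$ for the entrywise product (this last condition being trivial, with $v_0=1$, when $s=0$). -/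

import Mathlib

namespace SphericalScheme

/-- The unit sphere `S^{d-1}` in the Euclidean space `ℝ^d`. -/
abbrev UnitSphere (d : ℕ) : Type :=
  Metric.sphere (0 : EuclideanSpace ℝ (Fin d)) 1

/-- The coefficient `(d+k-3)/(d+2k-4)` of `Q_{k-1}` in the three-term recurrence, for `k ≥ 1`.
For `k = 1` the quotient is `(d-2)/(d-2)`, and it is read as `1` also when `d = 2`. -/
noncomputable def gegenbauerCoeff (d k : ℕ) : ℝ :=
  if k = 1 then 1 else ((d : ℝ) + k - 3) / ((d : ℝ) + 2 * k - 4)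

/-- The Gegenbauer polynomials on `S^{d-1}`: `Q_0 = 1`, `Q_1 = d x` and
`(k+1)/(d+2k) Q_{k+1} = x Q_k - (d+k-3)/(d+2k-4) Q_{k-1}` for `k ≥ 1`. -/
noncomputable def gegenbauer (d : ℕ) : ℕ → Polynomial ℝ
  | 0 => 1
  | 1 => Polynomial.C (d : ℝ) * Polynomial.X
  | k + 2 =>
      Polynomial.C (((d : ℝ) + 2 * ((k : ℝ) + 1)) / ((k : ℝ) + 2)) *
        (Polynomial.X * gegenbauer d (k + 1) -
          Polynomial.C (gegenbauerCoeff d (k + 1)) * gegenbauer d k)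

/-- `b_k = |X|⁻¹ ∑_{x,y ∈ X} Q_k(⟨x,y⟩)`. -/
noncomputable def gegenbauerMoment {d : ℕ} (X : Finset (UnitSphere d)) (k : ℕ) : ℝ :=
  (X.card : ℝ)⁻¹ * ∑ x ∈ X, ∑ y ∈ X,
    (gegenbauer d k).eval (inner ℝ (x : EuclideanSpace ℝ (Fin d)) (y : EuclideanSpace ℝ (Fin d)))

/-- The Laplacian `∑ᵢ ∂²/∂xᵢ²` on real polynomials in `d` variables. -/
noncomputable def polyLaplacian (d : ℕ) : MvPolynomial (Fin d) ℝ →ₗ[ℝ] MvPolynomial (Fin d) ℝ :=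
  ∑ i : Fin d, (MvPolynomial.pderiv i).toLinearMap ∘ₗ (MvPolynomial.pderiv i).toLinearMap

/-- `Harm_l(ℝ^d)`: the harmonic polynomials that are homogeneous of degree `l`. -/
noncomputable def harm (d l : ℕ) : Submodule ℝ (MvPolynomial (Fin d) ℝ) :=
  MvPolynomial.homogeneousSubmodule (Fin d) ℝ l ⊓ LinearMap.ker (polyLaplacian d)

/-- The value of a polynomial at a point of the sphere. -/
noncomputable def evalSphere {d : ℕ} (p : MvPolynomial (Fin d) ℝ) (x : UnitSphere d) : ℝ :=
  MvPolynomial.eval (fun i => (x : EuclideanSpace ℝ (Fin d)) i) p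

/-- `⟨p, q⟩ = |S^{d-1}|⁻¹ ∫_{S^{d-1}} p q dσ`, with `σ` the surface measure. -/
noncomputable def sphereInner {d : ℕ} (p q : MvPolynomial (Fin d) ℝ) : ℝ :=
  ⨍ x : UnitSphere d, evalSphere p x * evalSphere q x
    ∂((MeasureTheory.volume : MeasureTheory.Measure (EuclideanSpace ℝ (Fin d))).toSphere)

/-- `φ` is an orthonormal basis of `Harm_l(ℝ^d)`. -/
structure IsHarmOrthonormalBasis {d : ℕ} (l : ℕ) {h : ℕ}
    (φ : Fin h → MvPolynomial (Fin d) ℝ) : Prop where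
  orthonormal : ∀ i j, sphereInner (φ i) (φ j) = if i = j then 1 else 0
  span_eq : Submodule.span ℝ (Set.range φ) = harm d l

/-- The spherical characteristic matrix `H = (φ_i(x))_{x ∈ X, i}`. -/
noncomputable def charMatrix {d : ℕ} (X : Finset (UnitSphere d)) {h : ℕ}
    (φ : Fin h → MvPolynomial (Fin d) ℝ) : Matrix X (Fin h) ℝ :=
  Matrix.of fun x i => evalSphere (φ i) x.1

/-- `F = |X|⁻¹ H Hᵀ`. -/
noncomputable def charGram {d : ℕ} (X : Finset (UnitSphere d)) {h : ℕ}
    (φ : Fin h → MvPolynomial (Fin d) ℝ) : Matrix X X ℝ :=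
  (X.card : ℝ)⁻¹ • (charMatrix X φ * (charMatrix X φ).transpose)

open Classical in
/-- The degree set `A(X) = {⟨x,y⟩ | x, y ∈ X, x ≠ y}`. -/
noncomputable def degreeSet {d : ℕ} (X : Finset (UnitSphere d)) : Finset ℝ :=
  X.offDiag.image fun p =>
    inner ℝ (p.1 : EuclideanSpace ℝ (Fin d)) (p.2 : EuclideanSpace ℝ (Fin d))

/-- The relations `R_i = {(x,y) | ⟨x,y⟩ = α_i}` for an enumeration `α_1, …, α_s` of `A(X)`,
with `α_0 = 1`. -/
def innerRel {d : ℕ} (X : Finset (UnitSphere d)) {s : ℕ} (α : Fin s ≃ degreeSet X) :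
    Fin (s + 1) → X → X → Prop :=
  fun i x y =>
    inner ℝ (x.1 : EuclideanSpace ℝ (Fin d)) (y.1 : EuclideanSpace ℝ (Fin d)) =
      (Fin.cons 1 (fun j => (α j : ℝ)) : Fin (s + 1) → ℝ) i

/-- Symmetric association schemes with `s` classes on a finite non-empty set `V`. -/
structure IsSymmetricScheme {V : Type*} [Fintype V] {s : ℕ}
    (R : Fin (s + 1) → V → V → Prop) : Prop where
  nonempty : Nonempty V
  rel_nonempty : ∀ i, ∃ x y, R i x y
  partition : ∀ x y, ∃! i, R i x y
  diagonal : ∀ x y, R 0 x y ↔ x = y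
  symm : ∀ i x y, R i x y → R i y x
  intersection : ∃ p : Fin (s + 1) → Fin (s + 1) → Fin (s + 1) → ℕ,
    ∀ i j k x y, R k x y → Set.ncard {z | R i x z ∧ R j z y} = p i j k

open Classical in
/-- The adjacency matrix of a relation. -/
noncomputable def adjMatrix {V : Type*} (r : V → V → Prop) : Matrix V V ℝ :=
  Matrix.of fun x y => if r x y then 1 else 0

/-- The linear span of the adjacency matrices. -/
noncomputable def boseMesner {V : Type*} {s : ℕ} (R : Fin (s + 1) → V → V → Prop) :
    Submodule ℝ (Matrix V V ℝ) :=
  Submodule.span ℝ (Set.range fun i => adjMatrix (R i))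

open Classical in
/-- `E_0, …, E_s` is an ordering, starting with `E_0 = |V|⁻¹ J`, of the primitive idempotents of
the Bose-Mesner algebra. -/
structure IsPrimitiveIdempotents {V : Type*} [Fintype V] {s : ℕ}
    (R : Fin (s + 1) → V → V → Prop) (E : Fin (s + 1) → Matrix V V ℝ) : Prop where
  zero_eq : E 0 = Matrix.of fun _ _ => (Fintype.card V : ℝ)⁻¹
  ne_zero : ∀ i, E i ≠ 0
  mul_eq : ∀ i j, E i * E j = if i = j then E i else 0
  sum_eq : ∑ i, E i = 1
  span_eq : Submodule.span ℝ (Set.range E) = boseMesner R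

/-- `Q`-polynomial schemes with `s` classes: symmetric association schemes whose primitive
idempotents can be ordered as `E_0 = |V|⁻¹ J, E_1, …, E_s` in such a way that, for every `i`,
`|V| E_i` is a polynomial of degree exactly `i` in `|V| E_1` for the entrywise product.
(If `s = 0`, then `(1 : Fin 1) = 0`, and the condition holds automatically, with `v_0 = 1`.) -/
def IsQPolynomialScheme {V : Type*} [Fintype V] {s : ℕ}
    (R : Fin (s + 1) → V → V → Prop) : Prop :=
  IsSymmetricScheme R ∧
    ∃ E : Fin (s + 1) → Matrix V V ℝ, IsPrimitiveIdempotents R E ∧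
      ∃ v : Fin (s + 1) → Polynomial ℝ, ∀ i,
        (v i).degree = ((i : ℕ) : WithBot ℕ) ∧
          ∀ x y, (Fintype.card V : ℝ) * E i x y = (v i).eval ((Fintype.card V : ℝ) * E 1 x y)

end SphericalScheme

/-! ### Integration over the sphere by way of Gaussian integrals. -/

namespace SphericalScheme

open MeasureTheory MvPolynomial

/-! By the addition formula `sum_evalSphere_mul_evalSphere`, the entries of `F_k` are `|X|⁻¹
Q_k(⟨x,y⟩)`. Hence every `F_k` lies in the span `W` of the adjacency matrices, which has dimension
`s + 1`. That `W` is closed under multiplication is not known in advance; it comes out at the end.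

Put `G_i = F_{w+i}`. The hypothesis says that `G_i F_j = F_j G_i = 0` for `j < i ≤ s`. The analytic
core, `charGram_mul_ne_zero`, is that `G_i F_i ≠ 0`. Otherwise `∑_{z ∈ X} Q_{w+i}(⟨a,z⟩) Q_i(⟨a,z⟩)`
vanishes for all `a` on the sphere. Its harmonic component of degree `w` is a nonzero multiple of
`∑_z Q_w(⟨a,z⟩)`, and summing the latter over `a ∈ X` gives `b_w = 0`.

The rest is linear algebra. For each `i` the matrices `F_0, …, F_{i-1}, G_i, …, G_s` form a basis of
`W` (`exists_complementary_decomposition`): the two groups are orthogonal, and each is independent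
by triangularity. Let `e_i` be the component of the identity in the span of the `F_j` with `j < i`.
It acts as a two-sided identity on that span, so the `e_i` are nested idempotents and `E_i = e_{i+1}
- e_i` are nonzero orthogonal idempotents with sum `1` (`exists_orthogonal_idempotents`). By
dimension they span `W`, which is therefore an algebra. Since `E_i` is a combination of `F_0, …,
F_i` with nonzero coefficient at `F_i`, its entries are a polynomial of degree exactly `i` in
`⟨x,y⟩`. In particular `⟨x,y⟩` is an affine function of the entries of `E_1` when `s ≥ 1`, and the
`Q`-polynomial property follows. -/

lemma eval_smul_of_isHomogeneous {σ : Type*} {p : MvPolynomial σ ℝ} {k : ℕ}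
    (hp : p.IsHomogeneous k) (r : ℝ) (x : σ → ℝ) :
    eval (fun i => r * x i) p = r ^ k * eval x p := by
  rw [eval_eq, eval_eq, Finset.mul_sum]
  refine Finset.sum_congr rfl fun m hm => ?_
  have hdeg : ∑ i ∈ m.support, m i = k := (hp.degree_eq_sum_deg_support hm).symm
  simp only [mul_pow, Finset.prod_mul_distrib, Finset.prod_pow_eq_pow_sum, hdeg]
  ring

lemma integrable_pow_norm_mul_gaussian {d : ℕ} [NeZero d] (k : ℕ) :
    Integrable (fun x : EuclideanSpace ℝ (Fin d) => ‖x‖ ^ k * Real.exp (-‖x‖ ^ 2)) := by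
  rw [integrable_fun_norm_addHaar (volume : Measure (EuclideanSpace ℝ (Fin d)))
    (f := fun r => r ^ k * Real.exp (-r ^ 2))]
  have h := integrableOn_rpow_mul_exp_neg_mul_sq one_pos (s := ((d - 1 + k : ℕ) : ℝ))
    (lt_of_lt_of_le (by norm_num) (Nat.cast_nonneg _))
  refine h.congr_fun (fun r _ => ?_) measurableSet_Ioi
  simp only [Real.rpow_natCast, pow_add, smul_eq_mul, finrank_euclideanSpace, Fintype.card_fin]
  ring_nf

lemma integrable_eval_mul_gaussian {d : ℕ} [NeZero d] (p : MvPolynomial (Fin d) ℝ) :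
    Integrable (fun x : EuclideanSpace ℝ (Fin d) =>
      eval (fun i => x i) p * Real.exp (-‖x‖ ^ 2)) := by
  induction p using MvPolynomial.monomial_add_induction_on with
  | C a =>
    simpa using (integrable_pow_norm_mul_gaussian (d := d) 0).const_mul a
  | monomial_add m a f _ _ hf =>
    simp only [map_add, add_mul]
    refine Integrable.add ?_ hf
    refine ((integrable_pow_norm_mul_gaussian (d := d) (∑ i ∈ m.support, m i)).const_mul
      |a|).mono' ?_ ?_
    · refine Continuous.aestronglyMeasurable ?_
      exact ((MvPolynomial.continuous_eval _).comp (by fun_prop)).mul (by fun_prop)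
    · refine Filter.Eventually.of_forall fun x => ?_
      rw [eval_monomial, Real.norm_eq_abs, abs_mul, abs_mul, Real.abs_exp, Finsupp.prod,
        Finset.abs_prod, ← Finset.prod_pow_eq_pow_sum, mul_assoc]
      gcongr with i hi
      rw [abs_pow]
      gcongr
      exact PiLp.norm_apply_le x i

lemma hasDerivAt_eval_line {d : ℕ} (p : MvPolynomial (Fin d) ℝ) (i : Fin d)
    (x : EuclideanSpace ℝ (Fin d)) :
    HasLineDerivAt ℝ (fun x : EuclideanSpace ℝ (Fin d) => eval (fun j => x j) p)
      (eval (fun j => x j) (pderiv i p)) x (EuclideanSpace.single i 1) := by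
  unfold HasLineDerivAt
  induction p using MvPolynomial.induction_on with
  | C a => simpa using hasDerivAt_const (0 : ℝ) a
  | add p q hp hq =>
    simp only [map_add]
    exact hp.add hq
  | mul_X p j hp =>
    have hX : HasDerivAt (fun t : ℝ => (x + t • EuclideanSpace.single i (1 : ℝ)) j)
        (eval (fun j => x j) (pderiv i (X j))) 0 := by
      have h := ((hasDerivAt_id (0 : ℝ)).mul_const
        ((EuclideanSpace.single i (1 : ℝ)) j)).const_add (x j)
      refine h.congr_deriv ?_
      by_cases h : j = i
      · subst h
        simp
      · simp [pderiv_X_of_ne h, h]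
    simp only [map_mul, eval_X, pderiv_mul, map_add]
    refine (hp.mul hX).congr_deriv ?_
    simp

lemma hasLineDerivAt_gaussian {d : ℕ} (i : Fin d) (x : EuclideanSpace ℝ (Fin d)) :
    HasLineDerivAt ℝ (fun x : EuclideanSpace ℝ (Fin d) => Real.exp (-‖x‖ ^ 2))
      (-(2 * x i) * Real.exp (-‖x‖ ^ 2)) x (EuclideanSpace.single i 1) := by
  have h := ((hasStrictFDerivAt_norm_sq x).hasFDerivAt.neg.exp).hasLineDerivAt
    (EuclideanSpace.single i 1)
  refine HasDerivAt.congr_deriv h ?_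
  simp [EuclideanSpace.inner_single_right]
  ring

lemma integral_gaussian_by_parts {d : ℕ} [NeZero d] (p : MvPolynomial (Fin d) ℝ) (i : Fin d) :
    ∫ x : EuclideanSpace ℝ (Fin d), eval (fun j => x j) (pderiv i p) * Real.exp (-‖x‖ ^ 2) =
      2 * ∫ x : EuclideanSpace ℝ (Fin d), eval (fun j => x j) (X i * p) * Real.exp (-‖x‖ ^ 2) := by
  have hint : Integrable (fun x : EuclideanSpace ℝ (Fin d) => eval (fun j => x j) p *
      (-(2 * x i) * Real.exp (-‖x‖ ^ 2))) := by
    have := (integrable_eval_mul_gaussian (X i * p)).const_mul (-2)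
    refine this.congr (Filter.Eventually.of_forall fun x => ?_)
    simp only [map_mul, eval_X]
    ring
  have h := integral_bilinear_hasLineDerivAt_right_eq_neg_left_of_integrable
    (μ := (volume : Measure (EuclideanSpace ℝ (Fin d)))) (B := ContinuousLinearMap.mul ℝ ℝ)
    (v := EuclideanSpace.single i 1)
    (f := fun x : EuclideanSpace ℝ (Fin d) => eval (fun j => x j) p)
    (f' := fun x : EuclideanSpace ℝ (Fin d) => eval (fun j => x j) (pderiv i p))
    (g := fun x : EuclideanSpace ℝ (Fin d) => Real.exp (-‖x‖ ^ 2))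
    (g' := fun x : EuclideanSpace ℝ (Fin d) => -(2 * x i) * Real.exp (-‖x‖ ^ 2))
    (integrable_eval_mul_gaussian (pderiv i p)) hint
    (integrable_eval_mul_gaussian p)
    (fun x _ => hasDerivAt_eval_line p i x) (fun x _ => hasLineDerivAt_gaussian i x)
  simp only [ContinuousLinearMap.mul_apply'] at h
  rw [eq_neg_iff_add_eq_zero, add_comm, ← eq_neg_iff_add_eq_zero] at h
  rw [h, ← integral_neg, ← integral_const_mul]
  congr 1
  ext x
  simp only [map_mul, eval_X]
  ring

/-- The radial moment `∫_0^∞ r^k exp(-r²) r^n dr`. -/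
noncomputable def radialMoment (n k : ℕ) : ℝ :=
  ∫ r : Set.Ioi (0 : ℝ), r.1 ^ k * Real.exp (-r.1 ^ 2) ∂(Measure.volumeIoiPow n)

lemma radialMoment_eq (n k : ℕ) : radialMoment n k = 1 / 2 * Real.Gamma ((n + k + 1) / 2) := by
  have h := integral_rpow_mul_exp_neg_rpow (p := 2) (q := ((n + k : ℕ) : ℝ)) (by norm_num)
    (lt_of_lt_of_le (by norm_num) (Nat.cast_nonneg _))
  push_cast at h
  rw [← h, radialMoment]
  simp only [Measure.volumeIoiPow, ENNReal.ofReal]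
  rw [integral_withDensity_eq_integral_smul,
    integral_subtype_comap measurableSet_Ioi
      fun a => Real.toNNReal (a ^ n) • (a ^ k * Real.exp (-a ^ 2))]
  · refine setIntegral_congr_fun measurableSet_Ioi fun x hx => ?_
    have hx' : (0 : ℝ) < x := hx
    simp only [NNReal.smul_def, Real.coe_toNNReal _ (pow_nonneg hx'.le n), smul_eq_mul]
    rw [← Nat.cast_add, Real.rpow_natCast, pow_add, Real.rpow_two, mul_assoc]
  · exact (measurable_subtype_coe.pow_const _).real_toNNReal

lemma radialMoment_pos (n k : ℕ) : 0 < radialMoment n k := by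
  rw [radialMoment_eq]
  have := Real.Gamma_pos_of_pos (s := ((n : ℝ) + k + 1) / 2) (by positivity)
  positivity

lemma radialMoment_add_two (n k : ℕ) :
    2 * radialMoment n (k + 2) = (n + k + 1) * radialMoment n k := by
  rw [radialMoment_eq, radialMoment_eq]
  have h := Real.Gamma_add_one (s := ((n : ℝ) + k + 1) / 2) (by positivity)
  push_cast
  rw [show ((n : ℝ) + (k + 2) + 1) / 2 = (n + k + 1) / 2 + 1 by ring, h]
  ring

/-- In polar coordinates homogeneity turns the integrand into an angular factor times a radial one.
This transfers Gaussian integration by parts to the sphere. -/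
lemma integral_eval_mul_gaussian {d : ℕ} [NeZero d] {p : MvPolynomial (Fin d) ℝ} {k : ℕ}
    (hp : p.IsHomogeneous k) :
    ∫ x : EuclideanSpace ℝ (Fin d), eval (fun j => x j) p * Real.exp (-‖x‖ ^ 2) =
      (∫ x : UnitSphere d, evalSphere p x
        ∂((volume : Measure (EuclideanSpace ℝ (Fin d))).toSphere)) * radialMoment (d - 1) k := by
  set μ := (volume : Measure (EuclideanSpace ℝ (Fin d)))
  set f : EuclideanSpace ℝ (Fin d) → ℝ :=
    fun x => eval (fun j => x j) p * Real.exp (-‖x‖ ^ 2) with hf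
  have hdim : Module.finrank ℝ (EuclideanSpace ℝ (Fin d)) - 1 = d - 1 := by simp
  calc
    ∫ x, f x ∂μ = ∫ x : ({(0)}ᶜ : Set (EuclideanSpace ℝ (Fin d))), f x.1 ∂(μ.comap (↑)) := by
      rw [integral_subtype_comap (measurableSet_singleton _).compl f, restrict_compl_singleton]
    _ = ∫ z : UnitSphere d × Set.Ioi (0 : ℝ),
          evalSphere p z.1 * (z.2.1 ^ k * Real.exp (-z.2.1 ^ 2))
          ∂μ.toSphere.prod (.volumeIoiPow (d - 1)) := by
      rw [← hdim, ← μ.measurePreserving_homeomorphUnitSphereProd.integral_comp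
        (Homeomorph.measurableEmbedding _)]
      congr 1
      ext x
      have hx : ‖x.1‖ ≠ 0 := norm_ne_zero_iff.2 x.2
      have h := eval_smul_of_isHomogeneous hp ‖x.1‖
        (fun i => ((homeomorphUnitSphereProd _ x).1 : EuclideanSpace ℝ (Fin d)) i)
      simp only [hf, evalSphere, homeomorphUnitSphereProd_apply_snd_coe]
      rw [← mul_assoc, mul_comm (eval _ p) (‖x.1‖ ^ k), ← h]
      congr 3
      ext i
      simp [hx]
    _ = _ :=
      integral_prod_mul (evalSphere p)
        fun r : Set.Ioi (0 : ℝ) => r.1 ^ k * Real.exp (-r.1 ^ 2)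

/-- The mean of a polynomial over the unit sphere. -/
noncomputable def sphereMean {d : ℕ} (p : MvPolynomial (Fin d) ℝ) : ℝ :=
  ⨍ x : UnitSphere d, evalSphere p x
    ∂((volume : Measure (EuclideanSpace ℝ (Fin d))).toSphere)

lemma continuous_evalSphere {d : ℕ} (p : MvPolynomial (Fin d) ℝ) :
    Continuous (evalSphere p : UnitSphere d → ℝ) :=
  (MvPolynomial.continuous_eval p).comp (by fun_prop)

lemma integrable_evalSphere {d : ℕ} (p : MvPolynomial (Fin d) ℝ) :
    Integrable (evalSphere p : UnitSphere d → ℝ)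
      ((volume : Measure (EuclideanSpace ℝ (Fin d))).toSphere) :=
  (continuous_evalSphere p).integrable_of_hasCompactSupport (HasCompactSupport.of_compactSpace _)

lemma sphereMean_add {d : ℕ} (p q : MvPolynomial (Fin d) ℝ) :
    sphereMean (p + q) = sphereMean p + sphereMean q := by
  simp only [sphereMean, average_eq, ← smul_add]
  rw [← integral_add (integrable_evalSphere p) (integrable_evalSphere q)]
  simp [evalSphere]

lemma sphereMean_C_mul {d : ℕ} (a : ℝ) (p : MvPolynomial (Fin d) ℝ) :
    sphereMean (C a * p) = a * sphereMean p := by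
  simp only [sphereMean, average_eq, evalSphere, map_mul, eval_C, integral_const_mul, smul_eq_mul]
  ring

lemma sphereMean_congr {d : ℕ} {p q : MvPolynomial (Fin d) ℝ}
    (h : ∀ x : UnitSphere d, evalSphere p x = evalSphere q x) : sphereMean p = sphereMean q := by
  simp only [sphereMean, h]

lemma sphereMean_one {d : ℕ} [NeZero d] : sphereMean (1 : MvPolynomial (Fin d) ℝ) = 1 := by
  have : NeZero ((volume : Measure (EuclideanSpace ℝ (Fin d))).toSphere) :=
    ⟨Measure.toSphere_ne_zero _⟩
  simp [sphereMean, evalSphere, average_const]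

lemma sphereInner_eq {d : ℕ} (p q : MvPolynomial (Fin d) ℝ) :
    sphereInner p q = sphereMean (p * q) := by
  simp [sphereInner, sphereMean, evalSphere]

/-- The mean over the sphere as a linear functional. -/
noncomputable def sphereMeanLinear (d : ℕ) : MvPolynomial (Fin d) ℝ →ₗ[ℝ] ℝ where
  toFun := sphereMean
  map_add' := sphereMean_add
  map_smul' a p := by simp [MvPolynomial.smul_eq_C_mul, sphereMean_C_mul]

/-- Integration by parts on the sphere. -/
lemma sphereMean_X_mul {d : ℕ} [NeZero d] {p : MvPolynomial (Fin d) ℝ} {k : ℕ}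
    (hp : p.IsHomogeneous (k + 1)) (i : Fin d) :
    ((d : ℝ) + k) * sphereMean (X i * p) = sphereMean (pderiv i p) := by
  have h := integral_gaussian_by_parts p i
  rw [integral_eval_mul_gaussian (k := k) (by simpa using hp.pderiv),
    integral_eval_mul_gaussian ((isHomogeneous_X ℝ i).mul hp)] at h
  have hd : 0 < d := Nat.pos_of_ne_zero (NeZero.ne d)
  have h2 := radialMoment_add_two (d - 1) k
  rw [Nat.cast_sub hd, Nat.cast_one] at h2
  -- The two sides have degrees `k` and `k + 2`; the ratio `(d + k) / 2` of their radial moments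
  -- absorbs the `2` from differentiating the Gaussian.
  rw [show 1 + (k + 1) = k + 2 by ring, mul_left_comm, h2] at h
  have hpos := radialMoment_pos (d - 1) k
  have h3 : (∫ x : UnitSphere d, evalSphere (pderiv i p) x
      ∂((volume : Measure (EuclideanSpace ℝ (Fin d))).toSphere)) = ((d : ℝ) + k) *
      ∫ x : UnitSphere d, evalSphere (X i * p) x
        ∂((volume : Measure (EuclideanSpace ℝ (Fin d))).toSphere) := by
    apply mul_right_cancel₀ hpos.ne'
    rw [h]
    ring
  simp only [sphereMean, average_eq, smul_eq_mul, h3]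
  ring

/-- The case of a constant polynomial, which `sphereMean_X_mul` leaves out. -/
lemma sphereMean_X {d : ℕ} [NeZero d] (i : Fin d) : sphereMean (X i) = 0 := by
  have h := integral_gaussian_by_parts (1 : MvPolynomial (Fin d) ℝ) i
  rw [mul_one, integral_eval_mul_gaussian (isHomogeneous_X ℝ i)] at h
  have hpos := radialMoment_pos (d - 1) 1
  simp only [pderiv_one, map_zero, zero_mul, integral_zero] at h
  have h3 : (∫ x : UnitSphere d, evalSphere (X i) x
      ∂((volume : Measure (EuclideanSpace ℝ (Fin d))).toSphere)) = 0 := by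
    have := hpos.ne'
    have h' := h.symm
    simp only [mul_eq_zero, this, or_false, OfNat.ofNat_ne_zero, false_or] at h'
    exact h'
  simp [sphereMean, average_eq, h3]

end SphericalScheme

/-! ### Harmonic polynomials, their orthogonality, and means against powers of a linear form. -/

namespace SphericalScheme

open MvPolynomial

section Laplacian

variable {d : ℕ}

lemma polyLaplacian_apply (p : MvPolynomial (Fin d) ℝ) :
    polyLaplacian d p = ∑ i, pderiv i (pderiv i p) := by
  simp [polyLaplacian]

lemma mem_harm {l : ℕ} {p : MvPolynomial (Fin d) ℝ} :
    p ∈ harm d l ↔ p.IsHomogeneous l ∧ polyLaplacian d p = 0 := by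
  simp [harm, mem_homogeneousSubmodule]

lemma pderiv_pderiv_comm (i j : Fin d) (p : MvPolynomial (Fin d) ℝ) :
    pderiv i (pderiv j p) = pderiv j (pderiv i p) := by
  have h : ⁅pderiv (R := ℝ) i, pderiv (R := ℝ) j⁆ = 0 := by
    refine MvPolynomial.derivation_ext fun k => ?_
    rw [Derivation.commutator_apply, pderiv_X, pderiv_X]
    simp only [Pi.single_apply]
    split_ifs <;> simp
  have h2 := congrArg (fun D => D p) h
  simpa [Derivation.commutator_apply, sub_eq_zero] using h2

/-- The linear form `⟨·, y⟩`. -/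
noncomputable def linForm (y : Fin d → ℝ) : MvPolynomial (Fin d) ℝ := ∑ i, C (y i) * X i

/-- The derivative in direction `y`. -/
noncomputable def dirDeriv (y : Fin d → ℝ) :
    Derivation ℝ (MvPolynomial (Fin d) ℝ) (MvPolynomial (Fin d) ℝ) :=
  ∑ i, C (R := ℝ) (σ := Fin d) (y i) • pderiv (R := ℝ) i

lemma dirDeriv_apply (y : Fin d → ℝ) (p : MvPolynomial (Fin d) ℝ) :
    dirDeriv y p = ∑ i, C (y i) * pderiv i p := by
  rw [dirDeriv, ← Derivation.coeFnAddMonoidHom_apply, map_sum, Finset.sum_apply]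
  simp

/-- The polynomial `∑ xᵢ²`. -/
noncomputable def normSqPoly (d : ℕ) : MvPolynomial (Fin d) ℝ := ∑ i, X i ^ 2

lemma pderiv_linForm (y : Fin d → ℝ) (i : Fin d) : pderiv i (linForm y) = C (y i) := by
  simp [linForm, pderiv_X, Pi.single_apply]

lemma pderiv_normSqPoly (i : Fin d) : pderiv i (normSqPoly d) = 2 * X i := by
  simp [normSqPoly, pderiv_X, Pi.single_apply]

lemma isHomogeneous_linForm (y : Fin d → ℝ) : (linForm y).IsHomogeneous 1 :=
  IsHomogeneous.sum _ _ _ fun i _ => (isHomogeneous_X ℝ i).C_mul _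

lemma isHomogeneous_normSqPoly : (normSqPoly d).IsHomogeneous 2 :=
  IsHomogeneous.sum _ _ _ fun i _ => by simpa using (isHomogeneous_X ℝ i).pow 2

lemma dirDeriv_linForm {y : Fin d → ℝ} (hy : ∑ i, y i ^ 2 = 1) :
    dirDeriv y (linForm y) = 1 := by
  simp only [dirDeriv_apply, pderiv_linForm, ← map_mul, ← map_sum]
  simp [← pow_two, hy]

lemma dirDeriv_normSqPoly (y : Fin d → ℝ) :
    dirDeriv y (normSqPoly d) = 2 * linForm y := by
  simp only [dirDeriv_apply, pderiv_normSqPoly, linForm, Finset.mul_sum]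
  exact Finset.sum_congr rfl fun i _ => by ring

lemma polyLaplacian_mul (p q : MvPolynomial (Fin d) ℝ) :
    polyLaplacian d (p * q) = polyLaplacian d p * q + 2 * ∑ i, pderiv i p * pderiv i q +
      p * polyLaplacian d q := by
  simp only [polyLaplacian_apply, pderiv_mul, map_add, Finset.sum_mul, Finset.mul_sum,
    ← Finset.sum_add_distrib]
  exact Finset.sum_congr rfl fun i _ => by ring

lemma polyLaplacian_linForm_mul (y : Fin d → ℝ) (p : MvPolynomial (Fin d) ℝ) :
    polyLaplacian d (linForm y * p) = 2 * dirDeriv y p + linForm y * polyLaplacian d p := by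
  rw [polyLaplacian_mul, dirDeriv_apply]
  simp [polyLaplacian_apply (linForm y), pderiv_linForm]

lemma polyLaplacian_normSqPoly_mul {p : MvPolynomial (Fin d) ℝ} {k : ℕ}
    (hp : p.IsHomogeneous k) :
    polyLaplacian d (normSqPoly d * p) =
      (2 * (d : MvPolynomial (Fin d) ℝ) + 4 * k) * p + normSqPoly d * polyLaplacian d p := by
  have he := hp.sum_X_mul_pderiv
  have h1 : polyLaplacian d (normSqPoly d) = 2 * (d : MvPolynomial (Fin d) ℝ) := by
    have h2 : ∀ i : Fin d, pderiv i (2 : MvPolynomial (Fin d) ℝ) = 0 := fun i => by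
      rw [show (2 : MvPolynomial (Fin d) ℝ) = C 2 from rfl, pderiv_C]
    simp [polyLaplacian_apply, pderiv_normSqPoly, h2, mul_comm]
  rw [polyLaplacian_mul, h1]
  simp only [pderiv_normSqPoly, mul_assoc, ← Finset.mul_sum, he]
  rw [nsmul_eq_mul]
  ring

lemma pderiv_mem_harm {l : ℕ} {f : MvPolynomial (Fin d) ℝ} (hf : f ∈ harm d l) (i : Fin d) :
    pderiv i f ∈ harm d (l - 1) := by
  rw [mem_harm] at hf ⊢
  refine ⟨hf.1.pderiv, ?_⟩
  rw [polyLaplacian_apply]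
  simp only [pderiv_pderiv_comm _ i]
  rw [← map_sum, ← polyLaplacian_apply, hf.2, map_zero]

lemma dirDeriv_mem_harm {l : ℕ} {f : MvPolynomial (Fin d) ℝ} (hf : f ∈ harm d l)
    (y : Fin d → ℝ) : dirDeriv y f ∈ harm d (l - 1) := by
  rw [dirDeriv_apply]
  exact Submodule.sum_mem _ fun i _ => by
    rw [← smul_eq_C_mul]
    exact Submodule.smul_mem _ _ (pderiv_mem_harm hf i)

lemma eval_dirDeriv_self {l : ℕ} {f : MvPolynomial (Fin d) ℝ} (hf : f.IsHomogeneous l)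
    (y : Fin d → ℝ) : eval y (dirDeriv y f) = l * eval y f := by
  have h := congrArg (eval y) hf.sum_X_mul_pderiv
  simpa [dirDeriv_apply] using h

lemma sphereMean_sum {ι : Type*} (s : Finset ι) (f : ι → MvPolynomial (Fin d) ℝ) :
    sphereMean (∑ i ∈ s, f i) = ∑ i ∈ s, sphereMean (f i) :=
  map_sum (sphereMeanLinear d) f s

lemma sphereMean_zero : sphereMean (0 : MvPolynomial (Fin d) ℝ) = 0 :=
  map_zero (sphereMeanLinear d)

lemma sphereMean_natCast_mul (n : ℕ) (p : MvPolynomial (Fin d) ℝ) :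
    sphereMean ((n : MvPolynomial (Fin d) ℝ) * p) = n * sphereMean p := by
  rw [← sphereMean_C_mul, map_natCast]

end Laplacian

section Mean

variable {d : ℕ} [NeZero d]

lemma sphereMean_linForm_mul (y : Fin d → ℝ) {p : MvPolynomial (Fin d) ℝ} {k : ℕ}
    (hp : p.IsHomogeneous (k + 1)) :
    ((d : ℝ) + k) * sphereMean (linForm y * p) = sphereMean (dirDeriv y p) := by
  simp only [linForm, dirDeriv_apply, Finset.sum_mul, sphereMean_sum, mul_assoc,
    sphereMean_C_mul, Finset.mul_sum, ← sphereMean_X_mul hp]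
  exact Finset.sum_congr rfl fun i _ => by ring

/-- Euler's identity writes `(l + 1) f` as `∑ Xᵢ ∂ᵢf`, and integration by parts turns its mean into
a multiple of the mean of the Laplacian. In degree one the `∂ᵢf` are constants and the coordinates
have mean zero. -/
lemma sphereMean_harm {l : ℕ} {f : MvPolynomial (Fin d) ℝ} (hf : f ∈ harm d (l + 1)) :
    sphereMean f = 0 := by
  rw [mem_harm] at hf
  have he := congrArg sphereMean hf.1.sum_X_mul_pderiv
  rw [nsmul_eq_mul, sphereMean_natCast_mul, sphereMean_sum] at he
  have hl : ((l + 1 : ℕ) : ℝ) ≠ 0 := by positivity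
  suffices h : ∑ i, sphereMean (X i * pderiv i f) = 0 by
    rw [h] at he
    exact (mul_eq_zero.1 he.symm).resolve_left hl
  cases l with
  | zero =>
    refine Finset.sum_eq_zero fun i _ => ?_
    have h0 : (pderiv i f).totalDegree = 0 := by simpa using (hf.1.pderiv (i := i)).totalDegree_le
    rw [totalDegree_eq_zero_iff_eq_C.1 h0, mul_comm, sphereMean_C_mul, sphereMean_X, mul_zero]
  | succ m =>
    have hd : (d : ℝ) + m ≠ 0 := by
      have : (d : ℝ) ≠ 0 := Nat.cast_ne_zero.2 (NeZero.ne d)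
      positivity
    apply mul_left_cancel₀ hd
    rw [Finset.mul_sum, mul_zero, ← sphereMean_zero (d := d), ← hf.2, polyLaplacian_apply,
      sphereMean_sum]
    exact Finset.sum_congr rfl fun i _ => sphereMean_X_mul (by simpa using hf.1.pderiv) i

/-- Harmonic polynomials are orthogonal to the homogeneous polynomials of lower degree. -/
lemma sphereMean_harm_mul {k : ℕ} : ∀ {l : ℕ} {f g : MvPolynomial (Fin d) ℝ}, f ∈ harm d l →
    g.IsHomogeneous k → k < l → sphereMean (f * g) = 0 := by
  induction k using Nat.strong_induction_on with
  | _ k ih =>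
    intro l f g hf hg hkl
    obtain ⟨l, rfl⟩ : ∃ m, l = m + 1 := ⟨l - 1, by omega⟩
    cases k with
    | zero =>
      have h0 : g.totalDegree = 0 := by simpa using hg.totalDegree_le
      rw [totalDegree_eq_zero_iff_eq_C.1 h0, mul_comm, sphereMean_C_mul, sphereMean_harm hf,
        mul_zero]
    | succ k =>
      -- Euler's identity for `g` followed by integration by parts leaves `∂ᵢf ∂ᵢg` and `f ∂ᵢ∂ᵢg`,
      -- both covered by the induction hypothesis.
      have he := congrArg (fun q => sphereMean (f * q)) hg.sum_X_mul_pderiv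
      simp only [nsmul_eq_mul, mul_left_comm f, sphereMean_natCast_mul, Finset.mul_sum,
        sphereMean_sum] at he
      have hk : ((k + 1 : ℕ) : ℝ) ≠ 0 := by positivity
      rw [Finset.sum_eq_zero] at he
      · exact (mul_eq_zero.1 he.symm).resolve_left hk
      intro i _
      have hg' : (pderiv i g).IsHomogeneous k := by simpa using hg.pderiv
      have hd : (d : ℝ) + (l + k : ℕ) ≠ 0 := by
        have : (d : ℝ) ≠ 0 := Nat.cast_ne_zero.2 (NeZero.ne d)
        positivity
      apply mul_left_cancel₀ hd
      have hfg := (mem_harm.1 hf).1.mul hg'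
      rw [sphereMean_X_mul (by rwa [show l + k + 1 = l + 1 + k by ring]), mul_zero, pderiv_mul,
        sphereMean_add, ih k (by omega) (pderiv_mem_harm hf i) hg' (by omega),
        ih (k - 1) (by omega) hf hg'.pderiv (by omega), add_zero]

/-- The constant `l! / (d (d+2) ⋯ (d+2l-2))`. -/
noncomputable def zonalConst (d : ℕ) : ℕ → ℝ
  | 0 => 1
  | l + 1 => (l + 1) / (d + 2 * l) * zonalConst d l

/-- Integrating one factor of the linear form by parts differentiates along `y`. The term in which a
power of the form is differentiated vanishes by orthogonality; in the other, `∂_y f` is harmonic of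
degree one less, and Euler's identity gives its value at `y`. -/
lemma sphereMean_linForm_pow_mul {y : Fin d → ℝ} (hy : ∑ i, y i ^ 2 = 1) {l : ℕ} :
    ∀ {f : MvPolynomial (Fin d) ℝ}, f ∈ harm d l →
      sphereMean (linForm y ^ l * f) = zonalConst d l * eval y f := by
  induction l with
  | zero =>
    intro f hf
    have h0 : f.totalDegree = 0 := by simpa using (mem_harm.1 hf).1.totalDegree_le
    rw [totalDegree_eq_zero_iff_eq_C.1 h0, mul_comm, sphereMean_C_mul]
    simp [sphereMean_one, zonalConst]
  | succ l ih =>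
    intro f hf
    have hd : (d : ℝ) + 2 * l ≠ 0 := by
      have : (d : ℝ) ≠ 0 := Nat.cast_ne_zero.2 (NeZero.ne d)
      positivity
    have hpow : (linForm y ^ l).IsHomogeneous l := by
      simpa using (isHomogeneous_linForm y).pow l
    have hpow' : (linForm y ^ (l - 1)).IsHomogeneous (l - 1) := by
      simpa using (isHomogeneous_linForm y).pow (l - 1)
    have h := sphereMean_linForm_mul y (p := linForm y ^ l * f) (k := 2 * l)
      (by simpa [two_mul, add_assoc] using hpow.mul (mem_harm.1 hf).1)
    have hD : dirDeriv y (linForm y ^ l * f) =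
        linForm y ^ l * dirDeriv y f + (l : MvPolynomial (Fin d) ℝ) *
          (f * linForm y ^ (l - 1)) := by
      rw [Derivation.leibniz, Derivation.leibniz_pow, dirDeriv_linForm hy]
      simp only [smul_eq_mul, nsmul_eq_mul, mul_one]
      ring
    rw [hD, sphereMean_add, sphereMean_natCast_mul, sphereMean_harm_mul hf hpow' (by omega),
      ih (by simpa using dirDeriv_mem_harm hf y), eval_dirDeriv_self (mem_harm.1 hf).1] at h
    rw [pow_succ', mul_assoc, zonalConst]
    push_cast at h ⊢
    apply mul_left_cancel₀ hd
    rw [h]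
    linear_combination (-(zonalConst d l * eval y f)) * mul_div_cancel₀ ((l : ℝ) + 1) hd

end Mean

end SphericalScheme

/-! ### Zonal harmonics and the addition formula. -/

namespace SphericalScheme

open MvPolynomial

/-- Clearing the denominator removes the special case `k = 0`, including its convention for `d = 2`.
-/
lemma gegenbauerCoeff_mul {d : ℕ} [NeZero d] (k : ℕ) :
    gegenbauerCoeff d (k + 1) * ((d : ℝ) + 2 * k - 2) = d + k - 2 := by
  have hd : (1 : ℝ) ≤ d := Nat.one_le_cast.2 (Nat.one_le_iff_ne_zero.2 (NeZero.ne d))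
  cases k with
  | zero => simp [gegenbauerCoeff]
  | succ k =>
    have h : (d : ℝ) + 2 * k ≠ 0 := by positivity
    simp only [gegenbauerCoeff, add_eq_right, Nat.add_eq_zero_iff, one_ne_zero, and_false,
      if_false]
    push_cast
    rw [show (d : ℝ) + 2 * (k + 1 + 1) - 4 = d + 2 * k by ring,
      show (d : ℝ) + 2 * (k + 1) - 2 = d + 2 * k by ring, div_mul_cancel₀ _ h]
    ring

lemma gegenbauerCoeff_pos {d : ℕ} (hd : 2 ≤ d) (k : ℕ) : 0 < gegenbauerCoeff d (k + 1) := by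
  have hd' : (2 : ℝ) ≤ d := by exact_mod_cast hd
  unfold gegenbauerCoeff
  split_ifs with h
  · norm_num
  · have hk : (1 : ℝ) ≤ k := Nat.one_le_cast.2 (by omega)
    push_cast
    apply div_pos <;> linarith

/-- The homogenised Gegenbauer polynomial in `⟨·, y⟩`. -/
noncomputable def zonal {d : ℕ} (y : Fin d → ℝ) : ℕ → MvPolynomial (Fin d) ℝ
  | 0 => 1
  | 1 => C (d : ℝ) * linForm y
  | k + 2 =>
      C (((d : ℝ) + 2 * ((k : ℝ) + 1)) / ((k : ℝ) + 2)) *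
        (linForm y * zonal y (k + 1) -
          C (gegenbauerCoeff d (k + 1)) * (normSqPoly d * zonal y k))

variable {d : ℕ}

lemma isHomogeneous_zonal (y : Fin d → ℝ) (k : ℕ) : (zonal y k).IsHomogeneous k := by
  induction k using Nat.twoStepInduction with
  | zero => exact isHomogeneous_one _ _
  | one => exact (isHomogeneous_linForm y).C_mul _
  | more k h0 h1 =>
    refine IsHomogeneous.C_mul (IsHomogeneous.sub ?_ (IsHomogeneous.C_mul ?_ _)) _
    · have := (isHomogeneous_linForm y).mul h1
      rwa [show 1 + (k + 1) = k + 2 by ring] at this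
    · have := isHomogeneous_normSqPoly.mul h0
      rwa [add_comm] at this

lemma polyLaplacian_C_mul (a : ℝ) (p : MvPolynomial (Fin d) ℝ) :
    polyLaplacian d (C a * p) = C a * polyLaplacian d p := by
  rw [← smul_eq_C_mul, map_smul, smul_eq_C_mul]

/-- This is exactly what makes the two Laplacian terms of the recurrence cancel in `zonal_mem_harm`.
Evaluated at the pole it also gives the recursion for `Q_k(1)`. -/
lemma dirDeriv_zonal [NeZero d] {y : Fin d → ℝ} (hy : ∑ i, y i ^ 2 = 1) (k : ℕ) :
    dirDeriv y (zonal y (k + 1)) =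
      C (gegenbauerCoeff d (k + 1) * ((d : ℝ) + 2 * k)) * zonal y k := by
  have hd : (1 : ℝ) ≤ d := Nat.one_le_cast.2 (Nat.one_le_iff_ne_zero.2 (NeZero.ne d))
  induction k using Nat.twoStepInduction with
  | zero => simp [zonal, dirDeriv_linForm hy, gegenbauerCoeff]
  | one =>
    have h2 := gegenbauerCoeff_mul (d := d) 1
    push_cast at h2
    have hA : gegenbauerCoeff d 2 = (d - 1) / d := by
      rw [eq_div_iff (by positivity)]
      linear_combination h2
    simp only [zonal, derivation_C, map_sub, Derivation.leibniz, dirDeriv_linForm hy,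
      dirDeriv_normSqPoly, smul_eq_mul, Derivation.map_one_eq_zero, hA,
      show gegenbauerCoeff d (0 + 1) = 1 by simp [gegenbauerCoeff]]
    have h3 := congrArg (C (R := ℝ) (σ := Fin d)) (show ((d : ℝ) + 2 * (((0 : ℕ) : ℝ) + 1)) /
      (((0 : ℕ) : ℝ) + 2) * (d + d - 2) = ((d : ℝ) - 1) / d * (d + 2 * (1 : ℕ)) * d by
        field_simp
        push_cast
        ring)
    simp only [map_mul, map_add, map_sub] at h3 ⊢
    simp only [map_one, map_ofNat] at h3 ⊢
    linear_combination linForm y * h3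
  | more k h0 h1 =>
    have hk : (0 : ℝ) ≤ k := Nat.cast_nonneg k
    have hA := gegenbauerCoeff_mul (d := d) (k + 1)
    have hB := gegenbauerCoeff_mul (d := d) (k + 2)
    have hrec : zonal y (k + 2) = C (((d : ℝ) + 2 * ((k : ℝ) + 1)) / ((k : ℝ) + 2)) *
        (linForm y * zonal y (k + 1) -
          C (gegenbauerCoeff d (k + 1)) * (normSqPoly d * zonal y k)) := rfl
    rw [show zonal y (k + 2 + 1) =
      C (((d : ℝ) + 2 * (((k + 1 : ℕ) : ℝ) + 1)) / (((k + 1 : ℕ) : ℝ) + 2)) *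
        (linForm y * zonal y (k + 2) -
          C (gegenbauerCoeff d (k + 2)) * (normSqPoly d * zonal y (k + 1))) from rfl]
    simp only [derivation_C, map_sub, Derivation.leibniz, dirDeriv_linForm hy,
      dirDeriv_normSqPoly, smul_eq_mul, h0, h1]
    push_cast at hA hB ⊢
    rw [show k + 1 + 1 = k + 2 by ring] at *
    rw [show k + 2 + 1 = k + 3 by ring] at *
    generalize gegenbauerCoeff d (k + 1) = a at *
    generalize gegenbauerCoeff d (k + 2) = A at *
    generalize gegenbauerCoeff d (k + 3) = B at *
    have hB' : B = (d + k) / (d + 2 * k + 2) := by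
      rw [eq_div_iff (by positivity)]
      linear_combination hB
    have key : ((d : ℝ) + 2 * ((k : ℝ) + 1 + 1)) / ((k : ℝ) + 1 + 2) * ((d : ℝ) + k - 1) =
        (B * (d + 2 * (k + 2)) - (d + 2 * ((k : ℝ) + 1 + 1)) / ((k : ℝ) + 1 + 2)) *
          ((d + 2 * ((k : ℝ) + 1)) / ((k : ℝ) + 2)) := by
      rw [hB']
      have h1 : (d : ℝ) + 2 * k + 2 ≠ 0 := by positivity
      have h2 : (k : ℝ) + 3 ≠ 0 := by positivity
      have h3 : (k : ℝ) + 2 ≠ 0 := by positivity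
      have h4 : (k : ℝ) + 1 + 2 ≠ 0 := by positivity
      field_simp
      ring
    generalize ((d : ℝ) + 2 * ((k : ℝ) + 1 + 1)) / ((k : ℝ) + 1 + 2) = c at *
    generalize ((d : ℝ) + 2 * ((k : ℝ) + 1)) / ((k : ℝ) + 2) = e at *
    -- Once `zonal y (k + 2)` is expanded by the recurrence, `R1` and `R2` compare the coefficients
    -- of `linForm y * zonal y (k + 1)` and of `normSqPoly d * zonal y k`.
    have R1 := congrArg (C (R := ℝ) (σ := Fin d))
      (show c * (A * (d + 2 * (k + 1)) - 2 * A) = (B * (d + 2 * (k + 2)) - c) * e by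
        linear_combination key + c * hA)
    have R2 := congrArg (C (R := ℝ) (σ := Fin d))
      (show c * (A * (a * (d + 2 * k))) = (B * (d + 2 * (k + 2)) - c) * e * a by
        linear_combination a * key + c * a * hA)
    rw [hrec]
    simp only [map_mul, map_add, map_sub] at R1 R2 ⊢
    simp only [map_one, map_ofNat] at R1 R2 ⊢
    linear_combination (linForm y * zonal y (k + 1)) * R1 -
      (normSqPoly d * zonal y k) * R2

lemma zonal_mem_harm [NeZero d] {y : Fin d → ℝ} (hy : ∑ i, y i ^ 2 = 1) (k : ℕ) :
    zonal y k ∈ harm d k := by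
  rw [mem_harm]
  refine ⟨isHomogeneous_zonal y k, ?_⟩
  induction k using Nat.twoStepInduction with
  | zero => simp [zonal, polyLaplacian_apply]
  | one =>
    rw [zonal, polyLaplacian_C_mul, polyLaplacian_apply]
    simp [pderiv_linForm]
  | more k h0 h1 =>
    rw [zonal, polyLaplacian_C_mul, map_sub, polyLaplacian_C_mul, polyLaplacian_linForm_mul,
      polyLaplacian_normSqPoly_mul (isHomogeneous_zonal y k), h0, h1, dirDeriv_zonal hy]
    simp only [map_mul, map_add, map_natCast, map_ofNat]
    ring

lemma eval_zonal {x : Fin d → ℝ} (hx : ∑ i, x i ^ 2 = 1) (y : Fin d → ℝ) (k : ℕ) :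
    eval x (zonal y k) = (gegenbauer d k).eval (∑ i, x i * y i) := by
  have hl : eval x (linForm y) = ∑ i, x i * y i := by simp [linForm, mul_comm]
  have hn : eval x (normSqPoly d) = 1 := by simp [normSqPoly, hx]
  induction k using Nat.twoStepInduction with
  | zero => simp [zonal, gegenbauer]
  | one => simp [zonal, gegenbauer, hl]
  | more k h0 h1 => simp [zonal, gegenbauer, h0, h1, hl, hn]

lemma natDegree_gegenbauer_le (d k : ℕ) : (gegenbauer d k).natDegree ≤ k := by
  induction k using Nat.twoStepInduction with
  | zero => simp [gegenbauer]
  | one => exact (Polynomial.natDegree_C_mul_le _ _).trans Polynomial.natDegree_X_le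
  | more k h0 h1 =>
    refine (Polynomial.natDegree_C_mul_le _ _).trans
      ((Polynomial.natDegree_sub_le _ _).trans (max_le ?_ ?_))
    · exact Polynomial.natDegree_mul_le.trans
        (by have := Polynomial.natDegree_X_le (R := ℝ); omega)
    · exact (Polynomial.natDegree_C_mul_le _ _).trans (by omega)

lemma coeff_gegenbauer_succ (d k : ℕ) : (gegenbauer d (k + 1)).coeff (k + 1) =
    ((d : ℝ) + 2 * k) / (k + 1) * (gegenbauer d k).coeff k := by
  cases k with
  | zero => simp [gegenbauer]
  | succ k =>
    have h : (gegenbauer d k).coeff (k + 2) = 0 :=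
      Polynomial.coeff_eq_zero_of_natDegree_lt
        (lt_of_le_of_lt (natDegree_gegenbauer_le d k) (by omega))
    rw [gegenbauer, Polynomial.coeff_C_mul, Polynomial.coeff_sub, Polynomial.coeff_X_mul,
      Polynomial.coeff_C_mul, h]
    push_cast
    ring

lemma coeff_gegenbauer_pos [NeZero d] (k : ℕ) : 0 < (gegenbauer d k).coeff k := by
  induction k with
  | zero => simp [gegenbauer]
  | succ k ih =>
    rw [coeff_gegenbauer_succ]
    have hd : (0 : ℝ) < d := Nat.cast_pos.2 (Nat.pos_of_ne_zero (NeZero.ne d))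
    positivity

/-- The normalisation of `Q_k` is the one for which the reproducing kernel carries no constant. -/
lemma coeff_gegenbauer_mul_zonalConst [NeZero d] (k : ℕ) :
    (gegenbauer d k).coeff k * zonalConst d k = 1 := by
  induction k with
  | zero => simp [gegenbauer, zonalConst]
  | succ k ih =>
    have hd : (0 : ℝ) < d := Nat.cast_pos.2 (Nat.pos_of_ne_zero (NeZero.ne d))
    rw [coeff_gegenbauer_succ, zonalConst, ← ih]
    field_simp

/-- Only the term of degree `k` contributes, since `f` is orthogonal to lower powers of the linear
form. -/
lemma sphereMean_aeval_linForm_mul [NeZero d] {y : Fin d → ℝ} (hy : ∑ i, y i ^ 2 = 1)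
    {k : ℕ} {q : Polynomial ℝ} (hq : q.natDegree ≤ k) {f : MvPolynomial (Fin d) ℝ}
    (hf : f ∈ harm d k) :
    sphereMean (Polynomial.aeval (linForm y) q * f) = q.coeff k * zonalConst d k * eval y f := by
  rw [Polynomial.aeval_eq_sum_range' (Nat.lt_succ_of_le hq), Finset.sum_mul, sphereMean_sum,
    Finset.sum_range_succ, Finset.sum_eq_zero, zero_add, smul_eq_C_mul, mul_assoc,
    sphereMean_C_mul, sphereMean_linForm_pow_mul hy hf, mul_assoc]
  intro j hj
  rw [smul_eq_C_mul, mul_assoc, sphereMean_C_mul, mul_comm _ f, sphereMean_harm_mul hf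
    (by simpa using (isHomogeneous_linForm y).pow j) (Finset.mem_range.1 hj), mul_zero]

lemma sum_sq_unitSphere (x : UnitSphere d) : ∑ i, (x : EuclideanSpace ℝ (Fin d)) i ^ 2 = 1 := by
  rw [← EuclideanSpace.real_norm_sq_eq, norm_eq_of_mem_sphere, one_pow]

lemma inner_eq_sum (x y : UnitSphere d) :
    inner ℝ (x : EuclideanSpace ℝ (Fin d)) (y : EuclideanSpace ℝ (Fin d)) =
      ∑ i, (x : EuclideanSpace ℝ (Fin d)) i * (y : EuclideanSpace ℝ (Fin d)) i := by
  simp [PiLp.inner_apply, mul_comm]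

/-- The zonal harmonic of degree `k` with pole `y`. -/
noncomputable def zonalAt (y : UnitSphere d) (k : ℕ) : MvPolynomial (Fin d) ℝ :=
  zonal (fun i => (y : EuclideanSpace ℝ (Fin d)) i) k

lemma zonalAt_mem_harm [NeZero d] (y : UnitSphere d) (k : ℕ) : zonalAt y k ∈ harm d k :=
  zonal_mem_harm (sum_sq_unitSphere y) k

lemma evalSphere_zonalAt (y : UnitSphere d) (k : ℕ) (x : UnitSphere d) :
    evalSphere (zonalAt y k) x = (gegenbauer d k).eval
      (inner ℝ (x : EuclideanSpace ℝ (Fin d)) (y : EuclideanSpace ℝ (Fin d))) := by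
  rw [evalSphere, zonalAt, eval_zonal (sum_sq_unitSphere x), inner_eq_sum]

lemma evalSphere_aeval_linForm (y : UnitSphere d) (q : Polynomial ℝ) (x : UnitSphere d) :
    evalSphere (Polynomial.aeval
      (linForm fun i => (y : EuclideanSpace ℝ (Fin d)) i) q) x =
      q.eval (inner ℝ (x : EuclideanSpace ℝ (Fin d)) (y : EuclideanSpace ℝ (Fin d))) := by
  rw [evalSphere, inner_eq_sum, Polynomial.aeval_def, Polynomial.hom_eval₂, ← Polynomial.eval₂_id]
  congr 2
  · ext a
    simp
  · simp [linForm, mul_comm]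

/-- The zonal harmonics are reproducing kernels. -/
lemma sphereMean_zonalAt_mul [NeZero d] (y : UnitSphere d) {k : ℕ}
    {f : MvPolynomial (Fin d) ℝ} (hf : f ∈ harm d k) :
    sphereMean (zonalAt y k * f) = evalSphere f y := by
  have h := sphereMean_aeval_linForm_mul (sum_sq_unitSphere y) (natDegree_gegenbauer_le d k) hf
  rw [coeff_gegenbauer_mul_zonalConst, one_mul] at h
  rw [evalSphere, ← h]
  refine sphereMean_congr fun x => ?_
  have h := evalSphere_zonalAt y k x
  rw [← evalSphere_aeval_linForm] at h
  simp only [evalSphere, map_mul] at h ⊢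
  rw [h]

lemma sphereMean_harm_mul_harm [NeZero d] {k l : ℕ} (hkl : k ≠ l)
    {f g : MvPolynomial (Fin d) ℝ} (hf : f ∈ harm d k) (hg : g ∈ harm d l) :
    sphereMean (f * g) = 0 := by
  rcases lt_or_gt_of_ne hkl with h | h
  · rw [mul_comm]
    exact sphereMean_harm_mul hg (mem_harm.1 hf).1 h
  · exact sphereMean_harm_mul hf (mem_harm.1 hg).1 h

lemma sphereMean_zonalAt_mul_zonalAt [NeZero d] (y z : UnitSphere d) (k l : ℕ) :
    sphereMean (zonalAt y k * zonalAt z l) = if k = l then (gegenbauer d k).eval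
      (inner ℝ (y : EuclideanSpace ℝ (Fin d)) (z : EuclideanSpace ℝ (Fin d))) else 0 := by
  split_ifs with h
  · subst h
    rw [sphereMean_zonalAt_mul y (zonalAt_mem_harm z k), evalSphere_zonalAt]
  · exact sphereMean_harm_mul_harm h (zonalAt_mem_harm y k) (zonalAt_mem_harm z l)

/-- The addition formula. -/
lemma sum_evalSphere_mul_evalSphere [NeZero d] {l h : ℕ} {φ : Fin h → MvPolynomial (Fin d) ℝ}
    (hφ : IsHarmOrthonormalBasis l φ) (x y : UnitSphere d) :
    ∑ i, evalSphere (φ i) x * evalSphere (φ i) y = (gegenbauer d l).eval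
      (inner ℝ (x : EuclideanSpace ℝ (Fin d)) (y : EuclideanSpace ℝ (Fin d))) := by
  have hmem : ∀ i, φ i ∈ harm d l := fun i =>
    hφ.span_eq ▸ Submodule.subset_span (Set.mem_range_self i)
  have hz := zonalAt_mem_harm y l
  rw [← hφ.span_eq, Submodule.mem_span_range_iff_exists_fun] at hz
  obtain ⟨c, hc⟩ := hz
  -- Orthonormality gives the coefficient as the mean of the zonal harmonic times `φ i`, which the
  -- reproducing property evaluates.
  have hci : ∀ i, c i = evalSphere (φ i) y := fun i => by
    rw [← sphereMean_zonalAt_mul y (hmem i), ← hc, Finset.sum_mul, sphereMean_sum]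
    simp only [smul_eq_C_mul, mul_assoc, sphereMean_C_mul]
    simp [← sphereInner_eq, hφ.orthonormal]
  rw [← evalSphere_zonalAt, ← hc]
  simp [evalSphere, hci, mul_comm, smul_eval]

lemma gegenbauer_eval_one_succ [NeZero d] (k : ℕ) :
    ((k : ℝ) + 1) * (gegenbauer d (k + 1)).eval 1 =
      gegenbauerCoeff d (k + 1) * ((d : ℝ) + 2 * k) * (gegenbauer d k).eval 1 := by
  set e : Fin d → ℝ := Pi.single ⟨0, Nat.pos_of_ne_zero (NeZero.ne d)⟩ 1 with he
  have h1 : ∑ i, e i ^ 2 = 1 := by simp [he, Pi.single_apply]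
  have h2 : ∑ i, e i * e i = 1 := by simpa [pow_two] using h1
  have h := congrArg (eval e) (dirDeriv_zonal h1 k)
  rw [eval_dirDeriv_self (isHomogeneous_zonal e (k + 1)), eval_zonal h1, map_mul, eval_C,
    eval_zonal h1, h2] at h
  exact_mod_cast h

/-- This fails for `d = 1`, where the recurrence coefficient `gegenbauerCoeff 1 2` is zero. -/
lemma gegenbauer_eval_one_pos (hd : 2 ≤ d) (k : ℕ) : 0 < (gegenbauer d k).eval 1 := by
  have : NeZero d := ⟨by omega⟩
  induction k with
  | zero => simp [gegenbauer]
  | succ k ih =>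
    have h := gegenbauer_eval_one_succ (d := d) k
    have h2 := gegenbauerCoeff_pos hd k
    have h3 : (0 : ℝ) < d + 2 * k := by positivity
    have h4 : 0 < ((k : ℝ) + 1) * (gegenbauer d (k + 1)).eval 1 := by
      rw [h]
      positivity
    exact pos_of_mul_pos_right h4 (by positivity)

end SphericalScheme

/-! ### Gegenbauer expansions and the nonvanishing of `F_{w+i} F_i`. -/

namespace SphericalScheme

open MvPolynomial

variable {d : ℕ}

lemma exists_gegenbauer_expansion (d : ℕ) [NeZero d] {N : ℕ} :
    ∀ {q : Polynomial ℝ}, q.natDegree ≤ N → ∃ c : ℕ → ℝ,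
      q = ∑ m ∈ Finset.range (N + 1), c m • gegenbauer d m ∧
        c N * (gegenbauer d N).coeff N = q.coeff N := by
  induction N with
  | zero =>
    intro q hq
    refine ⟨fun _ => q.coeff 0, ?_, by simp [gegenbauer]⟩
    rw [Polynomial.eq_C_of_natDegree_le_zero hq]
    simp [gegenbauer, Polynomial.smul_eq_C_mul]
  | succ N ih =>
    intro q hq
    have hpos := (coeff_gegenbauer_pos (d := d) (N + 1)).ne'
    set a := q.coeff (N + 1) / (gegenbauer d (N + 1)).coeff (N + 1) with ha
    have ha' : a * (gegenbauer d (N + 1)).coeff (N + 1) = q.coeff (N + 1) :=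
      div_mul_cancel₀ _ hpos
    have hdeg : (q - a • gegenbauer d (N + 1)).natDegree ≤ N := by
      rw [Polynomial.natDegree_le_iff_coeff_eq_zero]
      intro m hm
      rcases Nat.lt_or_ge (N + 1) m with h | h
      · rw [Polynomial.coeff_sub, Polynomial.coeff_smul,
          Polynomial.coeff_eq_zero_of_natDegree_lt (lt_of_le_of_lt hq h),
          Polynomial.coeff_eq_zero_of_natDegree_lt
            (lt_of_le_of_lt (natDegree_gegenbauer_le d (N + 1)) h)]
        simp
      · obtain rfl : m = N + 1 := by omega
        simp [ha']
    obtain ⟨c, hc, -⟩ := ih hdeg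
    refine ⟨Function.update c (N + 1) a, ?_, by simpa using ha'⟩
    rw [Finset.sum_range_succ, Function.update_self, eq_comm, ← eq_sub_iff_add_eq, hc]
    refine Finset.sum_congr rfl fun m hm => ?_
    rw [Function.update_of_ne (Finset.mem_range.1 hm).ne]

/-- Pairing with a zonal harmonic of degree `w` isolates the `w`-th coefficient of the expansion. -/
lemma sphereMean_expansion_mul_zonalAt [NeZero d] (y z : UnitSphere d) {N w : ℕ} (hw : w < N)
    {q : Polynomial ℝ} {c : ℕ → ℝ} (hq : q = ∑ m ∈ Finset.range N, c m • gegenbauer d m) :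
    sphereMean (Polynomial.aeval (linForm fun i => (z : EuclideanSpace ℝ (Fin d)) i) q *
      zonalAt y w) = c w * (gegenbauer d w).eval
        (inner ℝ (z : EuclideanSpace ℝ (Fin d)) (y : EuclideanSpace ℝ (Fin d))) := by
  have h : sphereMean (Polynomial.aeval (linForm fun i => (z : EuclideanSpace ℝ (Fin d)) i) q *
      zonalAt y w) =
      sphereMean (∑ m ∈ Finset.range N, C (c m) * (zonalAt z m * zonalAt y w)) := by
    refine sphereMean_congr fun x => ?_
    have h1 := evalSphere_aeval_linForm z q x
    have h2 := fun m => evalSphere_zonalAt z m x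
    simp only [evalSphere, map_mul, map_sum, eval_C] at h1 h2 ⊢
    rw [h1, hq]
    simp only [h2, Polynomial.eval_finsetSum, Polynomial.eval_smul, smul_eq_mul,
      Finset.sum_mul, mul_assoc]
  rw [h, sphereMean_sum]
  simp only [sphereMean_C_mul, sphereMean_zonalAt_mul_zonalAt]
  rw [Finset.sum_eq_single w]
  · simp
  · intro m _ hm
    simp [hm]
  · intro h
    exact absurd (Finset.mem_range.2 hw) h

lemma charGram_apply [NeZero d] (X : Finset (UnitSphere d)) {l h : ℕ}
    {φ : Fin h → MvPolynomial (Fin d) ℝ} (hφ : IsHarmOrthonormalBasis l φ) (x y : X) :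
    charGram X φ x y = (X.card : ℝ)⁻¹ * (gegenbauer d l).eval
      (inner ℝ (x.1 : EuclideanSpace ℝ (Fin d)) (y.1 : EuclideanSpace ℝ (Fin d))) := by
  simp [charGram, charMatrix, Matrix.mul_apply, ← sum_evalSphere_mul_evalSphere hφ]

lemma transpose_charGram (X : Finset (UnitSphere d)) {h : ℕ}
    (φ : Fin h → MvPolynomial (Fin d) ℝ) : (charGram X φ).transpose = charGram X φ := by
  simp [charGram, Matrix.transpose_mul]

/-- Over the reals, `A Aᵀ B = 0` forces `Aᵀ B = 0`; this is applied on both sides of the product. -/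
lemma charMatrix_mul_eq_zero {X : Finset (UnitSphere d)} (hX : X.Nonempty) {h h' : ℕ}
    {φ : Fin h → MvPolynomial (Fin d) ℝ} {ψ : Fin h' → MvPolynomial (Fin d) ℝ}
    (H : charGram X φ * charGram X ψ = 0) :
    (charMatrix X φ).transpose * charMatrix X ψ = 0 := by
  have hn : (X.card : ℝ)⁻¹ ≠ 0 := inv_ne_zero (Nat.cast_ne_zero.2 hX.card_pos.ne')
  rw [charGram, charGram, Matrix.smul_mul, Matrix.mul_smul, smul_eq_zero_iff_right hn,
    smul_eq_zero_iff_right hn, ← Matrix.conjTranspose_eq_transpose_of_trivial (charMatrix X φ),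
    ← Matrix.conjTranspose_eq_transpose_of_trivial (charMatrix X ψ),
    Matrix.self_mul_conjTranspose_mul_eq_zero, Matrix.mul_self_mul_conjTranspose_eq_zero,
    Matrix.conjTranspose_eq_transpose_of_trivial] at H
  exact H

/-- The point `a` ranges over the whole sphere, not only over `X`, so that the identity can later be
integrated in `a`. -/
lemma sum_gegenbauer_mul_gegenbauer_eq_zero [NeZero d] {X : Finset (UnitSphere d)}
    (hX : X.Nonempty) {k l h h' : ℕ}
    {φ : Fin h → MvPolynomial (Fin d) ℝ} {ψ : Fin h' → MvPolynomial (Fin d) ℝ}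
    (hφ : IsHarmOrthonormalBasis k φ) (hψ : IsHarmOrthonormalBasis l ψ)
    (H : charGram X φ * charGram X ψ = 0) (a : UnitSphere d) :
    ∑ z ∈ X, (gegenbauer d k * gegenbauer d l).eval
      (inner ℝ (a : EuclideanSpace ℝ (Fin d)) (z : EuclideanSpace ℝ (Fin d))) = 0 := by
  have H' := charMatrix_mul_eq_zero hX H
  have hij : ∀ i j, ∑ z ∈ X, evalSphere (φ i) z * evalSphere (ψ j) z = 0 := fun i j => by
    have := congrFun (congrFun H' i) j
    rw [Matrix.mul_apply] at this
    simp only [charMatrix, Matrix.transpose_apply, Matrix.of_apply, Matrix.zero_apply] at this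
    rw [← this, ← Finset.sum_coe_sort X]
  simp only [Polynomial.eval_mul, ← sum_evalSphere_mul_evalSphere hφ,
    ← sum_evalSphere_mul_evalSphere hψ, Finset.sum_mul_sum]
  rw [Finset.sum_comm]
  refine Finset.sum_eq_zero fun i _ => ?_
  rw [Finset.sum_comm]
  refine Finset.sum_eq_zero fun j _ => ?_
  rw [← mul_zero (evalSphere (φ i) a * evalSphere (ψ j) a), ← hij i j, Finset.mul_sum]
  exact Finset.sum_congr rfl fun z _ => by ring

lemma charGram_mul_ne_zero [NeZero d] {X : Finset (UnitSphere d)} (hX : X.Nonempty)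
    {w i h h' : ℕ} {φ : Fin h → MvPolynomial (Fin d) ℝ} {ψ : Fin h' → MvPolynomial (Fin d) ℝ}
    (hφ : IsHarmOrthonormalBasis (w + i) φ) (hψ : IsHarmOrthonormalBasis i ψ)
    (hb : gegenbauerMoment X w ≠ 0) (hpos : 0 < (gegenbauer d (w + i)).eval 1) :
    charGram X φ * charGram X ψ ≠ 0 := by
  intro H
  obtain ⟨c, hc, -⟩ := exists_gegenbauer_expansion d (N := w + i + i)
    (q := gegenbauer d (w + i) * gegenbauer d i) (Polynomial.natDegree_mul_le.trans
      (add_le_add (natDegree_gegenbauer_le d _) (natDegree_gegenbauer_le d _)))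
  obtain ⟨e, he, he'⟩ := exists_gegenbauer_expansion d (N := w + i)
    (q := gegenbauer d w * gegenbauer d i) (Polynomial.natDegree_mul_le.trans
      (add_le_add (natDegree_gegenbauer_le d _) (natDegree_gegenbauer_le d _)))
  -- The vanishing function of `a` is paired with the zonal harmonic of degree `w` and pole `y`.
  have hzero : ∀ y : UnitSphere d, c w * ∑ z ∈ X, (gegenbauer d w).eval
      (inner ℝ (z : EuclideanSpace ℝ (Fin d)) (y : EuclideanSpace ℝ (Fin d))) = 0 := by
    intro y
    simp only [Finset.mul_sum,
      ← sphereMean_expansion_mul_zonalAt y _ (show w < w + i + i + 1 by omega) hc]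
    rw [← sphereMean_sum, ← sphereMean_zero (d := d)]
    refine sphereMean_congr fun a => ?_
    have h1 := sum_gegenbauer_mul_gegenbauer_eq_zero hX hφ hψ H a
    simp only [← evalSphere_aeval_linForm] at h1
    simp only [evalSphere, map_sum, map_mul, ← Finset.sum_mul, map_zero] at h1 ⊢
    rw [h1, zero_mul]
  -- The mean of `Q_{w+i} Q_i Q_w` is computed in two ways: as `c w * Q_w(1)` and as `e (w + i) *
  -- Q_{w+i}(1)`. The coefficient `e (w + i)` is nonzero because it is the top one in the expansion
  -- of `Q_w Q_i`.
  have hcw : c w ≠ 0 := by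
    obtain ⟨y, -⟩ := hX
    have h1 := sphereMean_expansion_mul_zonalAt y y (show w < w + i + i + 1 by omega) hc
    have h2 := sphereMean_expansion_mul_zonalAt y y (show w + i < w + i + 1 by omega) he
    have h3 : sphereMean (Polynomial.aeval (linForm fun i => (y : EuclideanSpace ℝ (Fin d)) i)
        (gegenbauer d (w + i) * gegenbauer d i) * zonalAt y w) =
        sphereMean (Polynomial.aeval (linForm fun i => (y : EuclideanSpace ℝ (Fin d)) i)
        (gegenbauer d w * gegenbauer d i) * zonalAt y (w + i)) := by
      refine sphereMean_congr fun x => ?_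
      have h4 := fun q => evalSphere_aeval_linForm y q x
      have h5 := fun m => evalSphere_zonalAt y m x
      simp only [evalSphere] at h4 h5
      simp only [evalSphere, map_mul, h4, h5]
      ring
    have hy : inner ℝ (y : EuclideanSpace ℝ (Fin d)) (y : EuclideanSpace ℝ (Fin d)) = 1 := by simp
    rw [h1, h2, hy] at h3
    have hew : e (w + i) ≠ 0 := by
      intro h0
      rw [h0, zero_mul, Polynomial.coeff_mul_add_eq_of_natDegree_le (natDegree_gegenbauer_le d _)
        (natDegree_gegenbauer_le d _)] at he'
      exact (mul_pos (coeff_gegenbauer_pos w) (coeff_gegenbauer_pos i)).ne he'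
    intro h0
    rw [h0, zero_mul] at h3
    exact mul_ne_zero hew hpos.ne' h3.symm
  apply hb
  rw [gegenbauerMoment, Finset.sum_comm, Finset.sum_eq_zero, mul_zero]
  exact fun y _ => (mul_eq_zero.1 (hzero y)).resolve_left hcw

lemma inner_eq_neg_one_of_ne {x y : UnitSphere 1} (hxy : x ≠ y) :
    inner ℝ (x : EuclideanSpace ℝ (Fin 1)) (y : EuclideanSpace ℝ (Fin 1)) = -1 := by
  have hx := sum_sq_unitSphere x
  have hy := sum_sq_unitSphere y
  have hne : (x : EuclideanSpace ℝ (Fin 1)) 0 ≠ (y : EuclideanSpace ℝ (Fin 1)) 0 := by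
    intro h
    apply hxy
    ext i
    rw [Subsingleton.elim i 0, h]
  rw [inner_eq_sum]
  simp only [Finset.univ_unique, Fin.default_eq_zero, Finset.sum_singleton] at hx hy ⊢
  have h : (x : EuclideanSpace ℝ (Fin 1)) 0 = -(y : EuclideanSpace ℝ (Fin 1)) 0 :=
    (sq_eq_sq_iff_eq_or_eq_neg.1 (hx.trans hy.symm)).resolve_left hne
  rw [h]
  linarith

/-- There are no nonzero harmonic polynomials of degree at least two in one variable. -/
lemma gegenbauer_one_eval {t : ℝ} (ht : t ^ 2 = 1) (k : ℕ) :
    (gegenbauer 1 (k + 2)).eval t = 0 := by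
  have h2 : (gegenbauer 1 2).eval t = 0 := by
    simp only [gegenbauer, gegenbauerCoeff]
    simp [← pow_two, ht]
  induction k using Nat.twoStepInduction with
  | zero => exact h2
  | one =>
    have h : gegenbauerCoeff 1 2 = 0 := by norm_num [gegenbauerCoeff]
    rw [gegenbauer]
    simp [h2, h]
  | more k h0 h1 =>
    rw [gegenbauer]
    simp [h0, h1]

/-- Only `d = 1` needs an argument: there `s ≤ 1`, and `b_w > 0` keeps `w + i` below `2`. -/
lemma gegenbauer_eval_one_pos_of_moment_pos [NeZero d] {X : Finset (UnitSphere d)} {w i : ℕ}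
    (hi : i ≤ (degreeSet X).card) (hb : 0 < gegenbauerMoment X w) :
    0 < (gegenbauer d (w + i)).eval 1 := by
  rcases Nat.lt_or_ge d 2 with hd | hd
  swap
  · exact gegenbauer_eval_one_pos hd _
  obtain rfl : d = 1 := by
    have := NeZero.ne d
    omega
  have hself : ∀ x : UnitSphere 1,
      inner ℝ (x : EuclideanSpace ℝ (Fin 1)) (x : EuclideanSpace ℝ (Fin 1)) = 1 := fun x => by simp
  have hsq : ∀ x y : UnitSphere 1,
      inner ℝ (x : EuclideanSpace ℝ (Fin 1)) (y : EuclideanSpace ℝ (Fin 1)) ^ 2 = 1 := by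
    intro x y
    by_cases h : x = y
    · rw [h, hself, one_pow]
    · rw [inner_eq_neg_one_of_ne h, neg_one_sq]
  have hcard : (degreeSet X).card ≤ 1 := by
    refine Finset.card_le_one_iff_subset_singleton.2 ⟨-1, fun a ha => ?_⟩
    obtain ⟨p, hp, rfl⟩ := Finset.mem_image.1 ha
    rw [inner_eq_neg_one_of_ne (Finset.mem_offDiag.1 hp).2.2, Finset.mem_singleton]
  have hw : w < 2 := by
    by_contra hw
    obtain ⟨k, rfl⟩ : ∃ k, w = k + 2 := ⟨w - 2, by omega⟩
    simp [gegenbauerMoment, gegenbauer_one_eval (hsq _ _)] at hb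
  have hwi : w + i < 2 := by
    by_contra hwi
    -- What remains is `w = i = 1`. Then `X` has at least two points, and each row sum `2 - |X|` of
    -- the values `Q_1(⟨x,y⟩)` is at most zero, against `b_1 > 0`.
    obtain rfl : w = 1 := by omega
    have hpos : 0 < (degreeSet X).card := by omega
    obtain ⟨a, ha⟩ := Finset.card_pos.1 hpos
    obtain ⟨p, hp, -⟩ := Finset.mem_image.1 ha
    rw [Finset.mem_offDiag] at hp
    have h2 : 1 < X.card := Finset.one_lt_card.2 ⟨p.1, hp.1, p.2, hp.2.1, hp.2.2⟩
    have h2' : (2 : ℝ) ≤ X.card := by exact_mod_cast h2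
    refine absurd hb (not_lt.2 ?_)
    refine mul_nonpos_of_nonneg_of_nonpos (by positivity) (Finset.sum_nonpos fun x hx => ?_)
    rw [← Finset.add_sum_erase X _ hx, Finset.sum_congr rfl fun y hy => by
      rw [inner_eq_neg_one_of_ne (Finset.ne_of_mem_erase hy).symm]]
    rw [hself, Finset.sum_const, Finset.card_erase_of_mem hx, nsmul_eq_mul,
      Nat.cast_sub h2.le]
    simp [gegenbauer]
    linarith
  interval_cases h : w + i <;> simp [gegenbauer]

end SphericalScheme

/-! ### Orthogonal idempotents from a triangular pair of matrix families. -/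

namespace SphericalScheme

section Triangular

variable {V : Type*} {s : ℕ} {F G : ℕ → Matrix V V ℝ}

lemma sum_range_split (i : ℕ) (hi : i ≤ s + 1) (c : ℕ → ℝ) :
    ∑ j ∈ Finset.range (s + 1), c j • (if j < i then F j else G j) =
      ∑ j ∈ Finset.range i, c j • F j + ∑ j ∈ Finset.Ico i (s + 1), c j • G j := by
  rw [← Finset.sum_range_add_sum_Ico _ hi]
  congr 1
  · exact Finset.sum_congr rfl fun j hj => by rw [if_pos (Finset.mem_range.1 hj)]
  · exact Finset.sum_congr rfl fun j hj => by
      rw [if_neg (not_lt.2 (Finset.mem_Ico.1 hj).1)]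

variable [Fintype V]

lemma sum_mul_eq_zero {ι κ : Type*} {S : Finset ι} {T : Finset κ} {f : ι → Matrix V V ℝ}
    {g : κ → Matrix V V ℝ} {a : ι → ℝ} {b : κ → ℝ} (h : ∀ i ∈ S, ∀ j ∈ T, f i * g j = 0) :
    (∑ i ∈ S, a i • f i) * (∑ j ∈ T, b j • g j) = 0 := by
  rw [Finset.sum_mul_sum]
  refine Finset.sum_eq_zero fun i hi => Finset.sum_eq_zero fun j hj => ?_
  rw [Matrix.smul_mul, Matrix.mul_smul, h i hi j hj, smul_zero, smul_zero]

lemma single_mul_sum_eq_zero {ι : Type*} {S : Finset ι} {f : ι → Matrix V V ℝ}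
    {B : Matrix V V ℝ} {a : ι → ℝ} (h : ∀ i ∈ S, B * f i = 0) :
    B * (∑ i ∈ S, a i • f i) = 0 := by
  rw [Finset.mul_sum]
  exact Finset.sum_eq_zero fun i hi => by rw [Matrix.mul_smul, h i hi, smul_zero]

/-- Left multiplication by the last `G` kills all terms but the top one, so coefficients vanish from
the top down. -/
lemma coeff_eq_zero_of_sum_range_eq_zero
    (hGF : ∀ i ≤ s, ∀ j < i, G i * F j = 0) (hne : ∀ i ≤ s, G i * F i ≠ 0)
    {n : ℕ} (hn : n ≤ s + 1) {a : ℕ → ℝ} (h : ∑ j ∈ Finset.range n, a j • F j = 0) :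
    ∀ j < n, a j = 0 := by
  induction n with
  | zero => simp
  | succ n ih =>
    have hG := congrArg (G n * ·) h
    simp only [mul_zero] at hG
    rw [Finset.sum_range_succ, mul_add, single_mul_sum_eq_zero
      (fun j hj => hGF n (by omega) j (Finset.mem_range.1 hj)), zero_add, Matrix.mul_smul,
      smul_eq_zero_iff_left (hne n (by omega))] at hG
    rw [Finset.sum_range_succ, hG, zero_smul, add_zero] at h
    intro j hj
    rcases Nat.lt_succ_iff_lt_or_eq.1 hj with hj | rfl
    · exact ih (by omega) h j hj
    · exact hG

/-- Right multiplication by `F j` kills the terms of index above `j`, so coefficients vanish from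
the bottom up. -/
lemma coeff_eq_zero_of_sum_Ico_eq_zero
    (hGF : ∀ i ≤ s, ∀ j < i, G i * F j = 0) (hne : ∀ i ≤ s, G i * F i ≠ 0)
    {n : ℕ} {b : ℕ → ℝ} (h : ∑ j ∈ Finset.Ico n (s + 1), b j • G j = 0) :
    ∀ j ∈ Finset.Ico n (s + 1), b j = 0 := by
  intro j
  induction j using Nat.strong_induction_on with
  | _ j ih =>
    intro hj
    have hF := congrArg (· * F j) h
    simp only [zero_mul] at hF
    rw [Finset.sum_mul, Finset.sum_eq_single j] at hF
    · rw [Matrix.smul_mul, smul_eq_zero_iff_left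
        (hne j (by have := Finset.mem_Ico.1 hj; omega))] at hF
      exact hF
    · intro m hm hmj
      rcases lt_or_gt_of_ne hmj with hlt | hgt
      · rw [ih m hlt hm, zero_smul, zero_mul]
      · rw [Matrix.smul_mul, hGF m (by have := Finset.mem_Ico.1 hm; omega) j hgt, smul_zero]
    · exact fun h' => absurd hj h'

variable [DecidableEq V]

lemma exists_complementary_decomposition (W : Submodule ℝ (Matrix V V ℝ))
    (hW : Module.finrank ℝ W = s + 1) (h1 : (1 : Matrix V V ℝ) ∈ W)
    (hFW : ∀ k, F k ∈ W) (hGW : ∀ k, G k ∈ W) (hFs : ∀ k, (F k).transpose = F k)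
    (hGF : ∀ i ≤ s, ∀ j < i, G i * F j = 0) (hFG : ∀ i ≤ s, ∀ j < i, F j * G i = 0)
    (hne : ∀ i ≤ s, G i * F i ≠ 0) {i : ℕ} (hi : i ≤ s + 1) :
    ∃ c : ℕ → ℝ, ∑ j ∈ Finset.range i, c j • F j +
      ∑ j ∈ Finset.Ico i (s + 1), c j • G j = 1 := by
  set B : ℕ → Matrix V V ℝ := fun j => if j < i then F j else G j with hB
  have hext : ∀ c : Fin (s + 1) → ℝ, ∃ c' : ℕ → ℝ, ∀ j : Fin (s + 1), c' j = c j := fun c =>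
    ⟨fun j => if h : j < s + 1 then c ⟨j, h⟩ else 0, fun j => dif_pos j.2⟩
  have hsum : ∀ c' : ℕ → ℝ, ∑ j : Fin (s + 1), c' j • B j =
      ∑ j ∈ Finset.range i, c' j • F j + ∑ j ∈ Finset.Ico i (s + 1), c' j • G j := fun c' => by
    rw [← sum_range_split i hi c', ← Fin.sum_univ_eq_sum_range fun j => c' j • B j]
  have hli : LinearIndependent ℝ fun j : Fin (s + 1) => B j := by
    rw [Fintype.linearIndependent_iff]
    intro c hc
    obtain ⟨c', hc'⟩ := hext c
    simp only [← hc'] at hc ⊢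
    rw [hsum] at hc
    have hAB : (∑ j ∈ Finset.range i, c' j • F j) *
        (∑ j ∈ Finset.Ico i (s + 1), c' j • G j) = 0 := by
      refine sum_mul_eq_zero fun j hj m hm => hFG m ?_ j ?_
      · have := Finset.mem_Ico.1 hm
        omega
      · exact (Finset.mem_range.1 hj).trans_le (Finset.mem_Ico.1 hm).1
    -- With `A + B = 0` and `A B = 0`, where `A` is symmetric, `Aᵀ A = A A = -(A B) = 0`.
    have hA : ∑ j ∈ Finset.range i, c' j • F j = 0 := by
      rw [← Matrix.conjTranspose_mul_self_eq_zero, Matrix.conjTranspose_eq_transpose_of_trivial,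
        Matrix.transpose_sum]
      simp only [Matrix.transpose_smul, hFs]
      rw [eq_neg_of_add_eq_zero_right hc, mul_neg, neg_eq_zero] at hAB
      exact hAB
    rw [hA, zero_add] at hc
    intro j
    by_cases hj : (j : ℕ) < i
    · exact coeff_eq_zero_of_sum_range_eq_zero hGF hne hi hA j hj
    · exact coeff_eq_zero_of_sum_Ico_eq_zero hGF hne hc j
        (Finset.mem_Ico.2 ⟨not_lt.1 hj, j.2⟩)
  have hspan : Submodule.span ℝ (Set.range fun j : Fin (s + 1) => B j) = W := by
    refine Submodule.eq_of_le_of_finrank_eq (Submodule.span_le.2 ?_) ?_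
    · rintro _ ⟨j, rfl⟩
      simp only [hB]
      split_ifs
      · exact hFW _
      · exact hGW _
    · rw [finrank_span_eq_card hli, hW, Fintype.card_fin]
  rw [← hspan, Submodule.mem_span_range_iff_exists_fun] at h1
  obtain ⟨c, hc⟩ := h1
  obtain ⟨c', hc'⟩ := hext c
  simp only [← hc'] at hc
  exact ⟨c', by rw [← hsum, hc]⟩

lemma exists_orthogonal_idempotents (W : Submodule ℝ (Matrix V V ℝ))
    (hW : Module.finrank ℝ W = s + 1) (h1 : (1 : Matrix V V ℝ) ∈ W)
    (hFW : ∀ k, F k ∈ W) (hGW : ∀ k, G k ∈ W)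
    (hFs : ∀ k, (F k).transpose = F k)
    (hGF : ∀ i ≤ s, ∀ j < i, G i * F j = 0) (hFG : ∀ i ≤ s, ∀ j < i, F j * G i = 0)
    (hne : ∀ i ≤ s, G i * F i ≠ 0) :
    ∃ (E : ℕ → Matrix V V ℝ) (a : ℕ → ℕ → ℝ),
      (∀ i ≤ s, E i = ∑ j ∈ Finset.range (i + 1), a i j • F j) ∧ (∀ i ≤ s, a i i ≠ 0) ∧
      (∀ i ≤ s, E i ≠ 0) ∧ (∀ i ≤ s, ∀ j ≤ s, E i * E j = if i = j then E i else 0) ∧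
      ∑ i ∈ Finset.range (s + 1), E i = 1 := by
  have hdec : ∀ i, ∃ c : ℕ → ℝ, i ≤ s + 1 → ∑ j ∈ Finset.range i, c j • F j +
      ∑ j ∈ Finset.Ico i (s + 1), c j • G j = 1 := fun i => by
    by_cases hi : i ≤ s + 1
    · obtain ⟨c, hc⟩ := exists_complementary_decomposition W hW h1 hFW hGW hFs hGF hFG hne hi
      exact ⟨c, fun _ => hc⟩
    · exact ⟨0, fun h => absurd h hi⟩
  choose c hc using hdec
  set e : ℕ → Matrix V V ℝ := fun i => ∑ j ∈ Finset.range i, c i j • F j with he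
  -- `e i` differs from `1` by a combination of the `G k` with `k ≥ i`, and these annihilate every
  -- `F j` with `j < i`.
  have hleft : ∀ i ≤ s + 1, ∀ (m : ℕ) (b : ℕ → ℝ), m ≤ i →
      e i * ∑ j ∈ Finset.range m, b j • F j = ∑ j ∈ Finset.range m, b j • F j := by
    intro i hi m b hm
    rw [show e i = 1 - ∑ j ∈ Finset.Ico i (s + 1), c i j • G j from eq_sub_of_add_eq (hc i hi),
      sub_mul, one_mul, sum_mul_eq_zero, sub_zero]
    intro k hk j hj
    rw [Finset.mem_Ico] at hk
    rw [Finset.mem_range] at hj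
    exact hGF k (by omega) j (by omega)
  have hright : ∀ i ≤ s + 1, ∀ (m : ℕ) (b : ℕ → ℝ), m ≤ i →
      (∑ j ∈ Finset.range m, b j • F j) * e i = ∑ j ∈ Finset.range m, b j • F j := by
    intro i hi m b hm
    rw [show e i = 1 - ∑ j ∈ Finset.Ico i (s + 1), c i j • G j from eq_sub_of_add_eq (hc i hi),
      mul_sub, mul_one, sum_mul_eq_zero, sub_zero]
    intro j hj k hk
    rw [Finset.mem_Ico] at hk
    rw [Finset.mem_range] at hj
    exact hFG k (by omega) j (by omega)
  have hee : ∀ i ≤ s + 1, ∀ j ≤ i, e i * e j = e j := fun i hi j hj => hleft i hi j _ hj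
  have hee' : ∀ i ≤ s + 1, ∀ j ≤ i, e j * e i = e j := fun i hi j hj => hright i hi j _ hj
  have hE : ∀ i, e (i + 1) - e i = ∑ j ∈ Finset.range (i + 1),
      (c (i + 1) j - if j < i then c i j else 0) • F j := by
    intro i
    simp only [sub_smul, Finset.sum_sub_distrib, he]
    congr 1
    rw [Finset.sum_range_succ, if_neg (lt_irrefl i), zero_smul, add_zero]
    exact Finset.sum_congr rfl fun j hj => by rw [if_pos (Finset.mem_range.1 hj)]
  -- `e (i + 1)` fixes `F i`, whereas `G i * e i = 0`; equality of the two would give `G i * F i =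
  -- 0`.
  have hE0 : ∀ i ≤ s, e (i + 1) - e i ≠ 0 := by
    intro i hi h0
    apply hne i hi
    have hF : e (i + 1) * F i = F i := by
      have := hleft (i + 1) (by omega) (i + 1) (Pi.single i 1) le_rfl
      simpa [Pi.single_apply, ite_smul] using this
    rw [← hF, sub_eq_zero.1 h0, ← mul_assoc,
      single_mul_sum_eq_zero fun j hj => hGF i hi j (Finset.mem_range.1 hj), zero_mul]
  refine ⟨fun i => e (i + 1) - e i, fun i j => c (i + 1) j - if j < i then c i j else 0,
    fun i _ => hE i, ?_, hE0, ?_, ?_⟩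
  · intro i hi h0
    beta_reduce at h0
    apply hE0 i hi
    -- Without its leading coefficient the difference would lie in the span of the `F j` with `j <
    -- i`, which `e i` fixes; but `e i` annihilates the difference.
    have h2 : e i * (e (i + 1) - e i) = e (i + 1) - e i := by
      rw [hE, Finset.sum_range_succ, h0, zero_smul, add_zero]
      exact hleft i (by omega) i _ le_rfl
    rw [← h2, mul_sub, hee' (i + 1) (by omega) i (by omega), hee i (by omega) i le_rfl, sub_self]
  · intro i hi j hj
    simp only [sub_mul, mul_sub]
    rcases lt_trichotomy i j with h | rfl | h
    · rw [hee' (j + 1) (by omega) (i + 1) (by omega), hee' (j + 1) (by omega) i (by omega),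
        hee' j (by omega) (i + 1) (by omega), hee' j (by omega) i (by omega), if_neg h.ne]
      abel
    · rw [hee (i + 1) (by omega) (i + 1) le_rfl, hee (i + 1) (by omega) i (by omega),
        hee' (i + 1) (by omega) i (by omega), hee i (by omega) i le_rfl, if_pos rfl]
      abel
    · rw [hee (i + 1) (by omega) (j + 1) (by omega), hee (i + 1) (by omega) j (by omega),
        hee i (by omega) (j + 1) (by omega), hee i (by omega) j (by omega), if_neg h.ne']
      abel
  · rw [Finset.sum_range_sub]
    have h2 := hc (s + 1) le_rfl
    simp only [Finset.Ico_self, Finset.sum_empty, add_zero] at h2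
    simp only [he, Finset.range_zero, Finset.sum_empty, sub_zero]
    exact h2

end Triangular

end SphericalScheme

/-! ### The Bose-Mesner space, inner product relations, and polynomials in the first idempotent. -/

namespace SphericalScheme

section BoseMesner

variable {V : Type*} {s : ℕ} {R : Fin (s + 1) → V → V → Prop}

lemma sum_smul_adjMatrix_apply (hp : ∀ x y, ∃! i, R i x y) (c : Fin (s + 1) → ℝ)
    {k : Fin (s + 1)} {x y : V} (h : R k x y) :
    (∑ i, c i • adjMatrix (R i)) x y = c k := by
  rw [Matrix.sum_apply, Finset.sum_eq_single k]
  · simp [adjMatrix, h]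
  · intro i _ hi
    have : ¬ R i x y := fun h' => hi ((hp x y).unique h' h)
    simp [adjMatrix, this]
  · simp

lemma mem_boseMesner_iff (hp : ∀ x y, ∃! i, R i x y) {M : Matrix V V ℝ} :
    M ∈ boseMesner R ↔ ∃ f : Fin (s + 1) → ℝ, ∀ k x y, R k x y → M x y = f k := by
  rw [boseMesner, Submodule.mem_span_range_iff_exists_fun]
  constructor
  · rintro ⟨c, rfl⟩
    exact ⟨c, fun k x y h => sum_smul_adjMatrix_apply hp c h⟩
  · rintro ⟨f, hf⟩
    refine ⟨f, ?_⟩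
    ext x y
    obtain ⟨k, hk, -⟩ := hp x y
    rw [sum_smul_adjMatrix_apply hp f hk, hf k x y hk]

lemma finrank_boseMesner (hp : ∀ x y, ∃! i, R i x y) (hne : ∀ i, ∃ x y, R i x y) :
    Module.finrank ℝ (boseMesner R) = s + 1 := by
  have hli : LinearIndependent ℝ fun i => adjMatrix (R i) := by
    rw [Fintype.linearIndependent_iff]
    intro c hc k
    obtain ⟨x, y, h⟩ := hne k
    rw [← sum_smul_adjMatrix_apply hp c h, hc, Matrix.zero_apply]
  rw [boseMesner, finrank_span_eq_card hli, Fintype.card_fin]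

variable [Fintype V]

lemma adjMatrix_mul_apply (r r' : V → V → Prop) (x y : V) :
    (adjMatrix r * adjMatrix r') x y = Set.ncard {z | r x z ∧ r' z y} := by
  classical
  rw [Matrix.mul_apply, Set.ncard_eq_toFinset_card', Finset.card_eq_sum_ones]
  simp [adjMatrix, ← ite_and, Set.toFinset_ofPred, and_comm]

lemma exists_intersectionNumbers (hp : ∀ x y, ∃! i, R i x y)
    (hmul : ∀ M ∈ boseMesner R, ∀ N ∈ boseMesner R, M * N ∈ boseMesner R) :
    ∃ p : Fin (s + 1) → Fin (s + 1) → Fin (s + 1) → ℕ,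
      ∀ i j k x y, R k x y → Set.ncard {z | R i x z ∧ R j z y} = p i j k := by
  have h : ∀ i j, ∃ f : Fin (s + 1) → ℝ, ∀ k x y, R k x y →
      (adjMatrix (R i) * adjMatrix (R j)) x y = f k := fun i j =>
    (mem_boseMesner_iff hp).1 (hmul _ (Submodule.subset_span ⟨i, rfl⟩) _
      (Submodule.subset_span ⟨j, rfl⟩))
  choose f hf using h
  -- The real constants `f i j k` are cardinalities as the entries of products of adjacency
  -- matrices; the floor recovers the natural number.
  refine ⟨fun i j k => ⌊f i j k⌋₊, fun i j k x y hk => ?_⟩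
  beta_reduce
  rw [← hf i j k x y hk, adjMatrix_mul_apply, Nat.floor_natCast]

lemma mul_mem_span_of_orthogonal {ι : Type*} [Fintype ι] [DecidableEq ι] {E : ι → Matrix V V ℝ}
    (hE : ∀ i j, E i * E j = if i = j then E i else 0) {M N : Matrix V V ℝ}
    (hM : M ∈ Submodule.span ℝ (Set.range E)) (hN : N ∈ Submodule.span ℝ (Set.range E)) :
    M * N ∈ Submodule.span ℝ (Set.range E) := by
  rw [Submodule.mem_span_range_iff_exists_fun] at hM hN
  obtain ⟨a, rfl⟩ := hM
  obtain ⟨b, rfl⟩ := hN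
  rw [Finset.sum_mul_sum]
  refine Submodule.sum_mem _ fun i _ => Submodule.sum_mem _ fun j _ => ?_
  rw [Matrix.smul_mul, Matrix.mul_smul, hE]
  refine Submodule.smul_mem _ _ (Submodule.smul_mem _ _ ?_)
  split_ifs
  · exact Submodule.subset_span ⟨i, rfl⟩
  · exact Submodule.zero_mem _

lemma linearIndependent_of_orthogonal {ι : Type*} [Fintype ι] [DecidableEq ι]
    {E : ι → Matrix V V ℝ} (hE : ∀ i j, E i * E j = if i = j then E i else 0)
    (h0 : ∀ i, E i ≠ 0) : LinearIndependent ℝ E := by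
  rw [Fintype.linearIndependent_iff]
  intro c hc i
  have h := congrArg (· * E i) hc
  simp only [Finset.sum_mul, Matrix.smul_mul, hE, zero_mul] at h
  rw [Finset.sum_eq_single i (fun j _ hj => by rw [if_neg hj, smul_zero]) (by simp),
    if_pos rfl, smul_eq_zero_iff_left (h0 i)] at h
  exact h

end BoseMesner

section InnerRel

variable {d s : ℕ} {X : Finset (UnitSphere d)} (α : Fin s ≃ degreeSet X)

/-- The values `α_0 = 1, α_1, …, α_s` of the inner product. -/
noncomputable def innerValue : Fin (s + 1) → ℝ :=
  Fin.cons 1 (fun j => (α j : ℝ))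

lemma inner_eq_one_iff {x y : UnitSphere d} :
    inner ℝ (x : EuclideanSpace ℝ (Fin d)) (y : EuclideanSpace ℝ (Fin d)) = 1 ↔ x = y := by
  rw [inner_eq_one_iff_of_norm_eq_one (norm_eq_of_mem_sphere x) (norm_eq_of_mem_sphere y),
    Subtype.coe_inj]

lemma innerValue_injective : Function.Injective (innerValue α) := by
  rw [innerValue, Fin.cons_injective_iff]
  refine ⟨?_, Subtype.val_injective.comp α.injective⟩
  rintro ⟨j, hj⟩
  obtain ⟨p, hp, hpj⟩ := Finset.mem_image.1 (α j).2
  exact (Finset.mem_offDiag.1 hp).2.2 (inner_eq_one_iff.1 (hpj.trans hj))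

lemma innerRel_zero_iff (x y : X) : innerRel X α 0 x y ↔ x = y := by
  rw [innerRel, Fin.cons_zero, inner_eq_one_iff, Subtype.coe_inj]

lemma innerRel_partition (x y : X) : ∃! i, innerRel X α i x y := by
  refine existsUnique_of_exists_of_unique ?_ fun i j hi hj => innerValue_injective α ?_
  · by_cases h : x = y
    · exact ⟨0, (innerRel_zero_iff α x y).2 h⟩
    · have hmem : inner ℝ (x.1 : EuclideanSpace ℝ (Fin d)) (y.1 : EuclideanSpace ℝ (Fin d)) ∈
          degreeSet X := Finset.mem_image.2 ⟨(x.1, y.1), Finset.mem_offDiag.2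
            ⟨x.2, y.2, fun h' => h (Subtype.ext h')⟩, rfl⟩
      refine ⟨(α.symm ⟨_, hmem⟩).succ, ?_⟩
      rw [innerRel, Fin.cons_succ, Equiv.apply_symm_apply]
  · exact hi.symm.trans hj

lemma innerRel_nonempty (hX : X.Nonempty) (i : Fin (s + 1)) : ∃ x y, innerRel X α i x y := by
  refine Fin.cases ?_ (fun j => ?_) i
  · obtain ⟨x, hx⟩ := hX
    exact ⟨⟨x, hx⟩, ⟨x, hx⟩, (innerRel_zero_iff α _ _).2 rfl⟩
  · obtain ⟨p, hp, hpj⟩ := Finset.mem_image.1 (α j).2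
    rw [Finset.mem_offDiag] at hp
    exact ⟨⟨p.1, hp.1⟩, ⟨p.2, hp.2.1⟩, by rw [innerRel, Fin.cons_succ, ← hpj]⟩

/-- The function `f` is arbitrary, so that the identity matrix is covered along with the `F_k`. -/
lemma of_inner_mem_boseMesner (f : ℝ → ℝ) {M : Matrix X X ℝ} (hM : ∀ x y, M x y =
    f (inner ℝ (x.1 : EuclideanSpace ℝ (Fin d)) (y.1 : EuclideanSpace ℝ (Fin d)))) :
    M ∈ boseMesner (innerRel X α) :=
  (mem_boseMesner_iff (innerRel_partition α)).2
    ⟨fun k => f (innerValue α k), fun k x y h => by rw [hM, h, innerValue]⟩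

end InnerRel

/-- As `p 1` has degree one, `t` is an affine function `q` of `n * E 1`, and `v i = (n * p i) ∘ q`
keeps the degree. When `s = 0` the index `1` is `0` and the constant `1` serves. -/
lemma exists_polynomial_in_first {ι : Type*} {s : ℕ} {n : ℝ} (hn : n ≠ 0)
    {t : ι → ℝ} {E : Fin (s + 1) → ι → ℝ} {p : ℕ → Polynomial ℝ}
    (hdeg : ∀ i ≤ s, (p i).degree = (i : WithBot ℕ))
    (hE : ∀ (i : Fin (s + 1)) x, E i x = (p i).eval (t x))
    (h0 : ∀ x, n * E 0 x = 1) :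
    ∃ v : Fin (s + 1) → Polynomial ℝ, ∀ i, (v i).degree = ((i : ℕ) : WithBot ℕ) ∧
      ∀ x, n * E i x = (v i).eval (n * E 1 x) := by
  cases s with
  | zero =>
    refine ⟨fun _ => 1, fun i => ?_⟩
    obtain rfl : i = 0 := Fin.fin_one_eq_zero i
    simpa using h0
  | succ s =>
    have h1 := hdeg 1 (by omega)
    set b := (p 1).coeff 1 with hb
    have hp1 : p 1 = Polynomial.C b * Polynomial.X + Polynomial.C ((p 1).coeff 0) :=
      Polynomial.eq_X_add_C_of_degree_le_one h1.le
    have hb0 : b ≠ 0 := by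
      exact Polynomial.coeff_ne_zero_of_eq_degree h1
    set q : Polynomial ℝ := Polynomial.C (n * b)⁻¹ * Polynomial.X +
      Polynomial.C (-(p 1).coeff 0 / b) with hq
    have hqd : q.degree = 1 := Polynomial.degree_linear (inv_ne_zero (mul_ne_zero hn hb0))
    have ht : ∀ x, q.eval (n * E 1 x) = t x := fun x => by
      rw [hE, Fin.val_one, hp1]
      simp only [hq, Polynomial.eval_add, Polynomial.eval_mul, Polynomial.eval_C,
        Polynomial.eval_X]
      field_simp
      ring
    refine ⟨fun i => (Polynomial.C n * p i).comp q, fun i => ⟨?_, fun x => ?_⟩⟩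
    · rw [Polynomial.degree_comp (by rw [hqd]; exact zero_lt_one), hqd, mul_one,
        Polynomial.degree_C_mul hn, hdeg i (by omega)]
    · rw [Polynomial.eval_comp, ht, Polynomial.eval_mul, Polynomial.eval_C, hE]

lemma degree_sum_gegenbauer {d : ℕ} [NeZero d] {i : ℕ} {a : ℕ → ℝ} (ha : a i ≠ 0) :
    (∑ j ∈ Finset.range (i + 1), a j • gegenbauer d j).degree = (i : WithBot ℕ) := by
  refine le_antisymm ?_ (Polynomial.le_degree_of_ne_zero ?_)
  · refine (Polynomial.degree_sum_le _ _).trans (Finset.sup_le fun j hj => ?_)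
    refine (Polynomial.degree_smul_le _ _).trans (Polynomial.degree_le_of_natDegree_le ?_)
    exact (natDegree_gegenbauer_le d j).trans (by have := Finset.mem_range.1 hj; omega)
  · rw [Polynomial.finsetSum_coeff, Finset.sum_range_succ, Finset.sum_eq_zero, zero_add,
      Polynomial.coeff_smul, smul_eq_mul]
    · exact mul_ne_zero ha (coeff_gegenbauer_pos i).ne'
    · intro j hj
      rw [Polynomial.coeff_smul, Polynomial.coeff_eq_zero_of_natDegree_lt
        (lt_of_le_of_lt (natDegree_gegenbauer_le d j) (Finset.mem_range.1 hj)), smul_zero]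

end SphericalScheme

/-! ### Assembly of the scheme. -/

open SphericalScheme in
theorem mainTheorem7 {d : ℕ} (X : Finset (SphericalScheme.UnitSphere d)) (hX : X.Nonempty)
    (s : ℕ) (hs : (SphericalScheme.degreeSet X).card = s)
    (h : ℕ → ℕ) (φ : (l : ℕ) → Fin (h l) → MvPolynomial (Fin d) ℝ)
    (hφ : ∀ l, SphericalScheme.IsHarmOrthonormalBasis l (φ l))
    (w : ℕ) (hb : 0 < SphericalScheme.gegenbauerMoment X w)
    (hF : ∀ k l : ℕ, k ≤ w + s → l ≤ w + s → (w : ℤ) + 1 ≤ |(k : ℤ) - (l : ℤ)| →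
      SphericalScheme.charGram X (φ k) * SphericalScheme.charGram X (φ l) = 0)
    (α : Fin s ≃ SphericalScheme.degreeSet X) :
    SphericalScheme.IsQPolynomialScheme (SphericalScheme.innerRel X α) := by
  classical
  have : NeZero d := ⟨by
    rintro rfl
    obtain ⟨x, -⟩ := hX
    have := sum_sq_unitSphere x
    simp at this⟩
  have hn : (X.card : ℝ) ≠ 0 := Nat.cast_ne_zero.2 hX.card_pos.ne'
  set F : ℕ → Matrix X X ℝ := fun k => charGram X (φ k)
  have hpart := innerRel_partition α
  have hne := innerRel_nonempty α hX
  have hmem : ∀ k, F k ∈ boseMesner (innerRel X α) := fun k =>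
    of_inner_mem_boseMesner α (fun t => (X.card : ℝ)⁻¹ * (gegenbauer d k).eval t)
      (charGram_apply X (hφ k))
  have hone : (1 : Matrix X X ℝ) ∈ boseMesner (innerRel X α) :=
    of_inner_mem_boseMesner α (fun t => if t = 1 then 1 else 0) fun x y => by
      simp only [Matrix.one_apply, inner_eq_one_iff, Subtype.coe_inj]
  obtain ⟨E, a, hEa, ha, hE0, hEE, hEsum⟩ :=
    exists_orthogonal_idempotents (F := F) (G := fun i => F (w + i)) (s := s)
      (boseMesner (innerRel X α)) (finrank_boseMesner hpart hne) hone hmem (fun k => hmem _)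
      (fun k => transpose_charGram X (φ k))
      -- For `j < i ≤ s` the indices `w + i` and `j` differ by at least `w + 1` and do not exceed `w
      -- + s`.
      (fun i hi j hj => hF _ _ (by omega) (by omega) (by rw [le_abs]; left; push_cast; omega))
      (fun i hi j hj => hF _ _ (by omega) (by omega) (by rw [le_abs]; right; push_cast; omega))
      (fun i hi => charGram_mul_ne_zero hX (hφ _) (hφ _) hb.ne'
        (gegenbauer_eval_one_pos_of_moment_pos (hs.symm ▸ hi) hb))
  have hEE' : ∀ i j : Fin (s + 1), E i * E j = if i = j then E i else 0 := fun i j => by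
    rw [hEE i (by omega) j (by omega)]
    simp only [Fin.ext_iff]
  have hspan : Submodule.span ℝ (Set.range fun i : Fin (s + 1) => E i) =
      boseMesner (innerRel X α) := by
    refine Submodule.eq_of_le_of_finrank_eq (Submodule.span_le.2 ?_) ?_
    · rintro _ ⟨i, rfl⟩
      beta_reduce
      rw [hEa i (by omega)]
      exact Submodule.sum_mem _ fun j _ => Submodule.smul_mem _ _ (hmem j)
    · rw [finrank_boseMesner hpart hne, finrank_span_eq_card
        (linearIndependent_of_orthogonal hEE' fun i => hE0 i (by omega)), Fintype.card_fin]
  set p : ℕ → Polynomial ℝ := fun i =>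
    ∑ j ∈ Finset.range (i + 1), (a i j * (X.card : ℝ)⁻¹) • gegenbauer d j with hp
  have hEp : ∀ i ≤ s, ∀ x y, E i x y = (p i).eval
      (inner ℝ (x.1 : EuclideanSpace ℝ (Fin d)) (y.1 : EuclideanSpace ℝ (Fin d))) := by
    intro i hi x y
    rw [hEa i hi, Matrix.sum_apply, hp, Polynomial.eval_finsetSum]
    refine Finset.sum_congr rfl fun j _ => ?_
    have hj : F j x y = _ := charGram_apply X (hφ j) x y
    rw [Matrix.smul_apply, hj, Polynomial.eval_smul, smul_eq_mul,
      smul_eq_mul, mul_assoc]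
  have hE00 : ∀ x y, E 0 x y = (X.card : ℝ)⁻¹ := by
    have h1 : ∀ x y, E 0 x y = a 0 0 * (X.card : ℝ)⁻¹ := fun x y => by
      rw [hEp 0 (Nat.zero_le s)]
      simp [hp, gegenbauer]
    obtain ⟨x, hx⟩ := hX
    have h2 := congrFun (congrFun (hEE 0 (Nat.zero_le s) 0 (Nat.zero_le s)) ⟨x, hx⟩) ⟨x, hx⟩
    rw [if_pos rfl, Matrix.mul_apply] at h2
    simp only [h1, Finset.sum_const, Finset.card_univ, Fintype.card_coe, nsmul_eq_mul] at h2
    -- `E 0` is the constant matrix with entries `a 0 0 / |X|`; being idempotent and nonzero it must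
    -- have `a 0 0 = 1`.
    have h3 : a 0 0 * a 0 0 = a 0 0 * 1 := by
      field_simp at h2
      linarith
    rw [mul_left_cancel₀ (ha 0 (Nat.zero_le s)) h3] at h1
    simpa using h1
  refine ⟨⟨hX.to_subtype, hne, hpart, innerRel_zero_iff α, ?_, ?_⟩, fun i => E i,
    ⟨?_, fun i => hE0 i (by omega), ?_, ?_, hspan⟩, ?_⟩
  · intro i x y hxy
    rw [innerRel, real_inner_comm]
    exact hxy
  · refine exists_intersectionNumbers hpart fun M hM N hN => ?_
    rw [← hspan] at hM hN ⊢
    exact mul_mem_span_of_orthogonal hEE' hM hN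
  · ext x y
    simp [hE00]
  · exact fun i j => by convert hEE' i j
  · rw [Fin.sum_univ_eq_sum_range E (s + 1), hEsum]
    congr!
  · rw [Fintype.card_coe]
    obtain ⟨v, hv⟩ := exists_polynomial_in_first (s := s) (p := p) (ι := X × X) hn
      (t := fun z => inner ℝ (z.1.1 : EuclideanSpace ℝ (Fin d)) (z.2.1 : EuclideanSpace ℝ (Fin d)))
      (E := fun i z => E i z.1 z.2)
      (fun i hi => degree_sum_gegenbauer (mul_ne_zero (ha i hi) (inv_ne_zero hn)))
      (fun i z => hEp i (by omega) z.1 z.2)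
      (fun z => by rw [Fin.val_zero, hE00, mul_inv_cancel₀ hn])
    exact ⟨v, fun i => ⟨(hv i).1, fun x y => (hv i).2 (x, y)⟩⟩
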